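/- Let $n,k,N$ be positive integers, put $\tau=2k-1$, and suppose $D(n,\tau)<N\le D(n,\tau+1)$, where $D(n,2k-1)=2\binom{n+k-2}{n-1}$ and $D(n,2k)=\binom{n+k-1}{n-1}+\binom{n+k-2}{n-1}$. Let $h:[-1,1]\to[0,+\infty]$ be absolutely monotone: $h$ is finite and infinitely differentiable on $[-1,1)$ with $h^{(m)}(t)\ge 0$ for all $m\ge 0$ and $t\in[-1,1)$. A spherical $\tau$-design is a nonempty finite set $C\subset\mathbb S^{n-1}$ such that $\frac1{|C|}\sum_{x\in C}f(x)$ equals the mean of $f$ over $\mathbb S^{n-1}$ (with respect to surface area) for every polynomial $f$ in $n$ variables of total degree at most $\tau$. Put $E(n,C;h)=\sum_{x,y\in C,\,x\ne y}h(\langle x,y\rangle)$ and $u(C)=\max\{\langle x,y\rangle: x,y\in C,\ x\neq y\}$. Let $\mathcal U(n,N,\tau;h)$ and $\mathcal L(n,N,\tau;h)$ be the supremum and the infimum of $E(n,C;h)$, and $u(n,N,\tau)$ the supremum of $u(C)$, over all spherical $\tau$-designs $C\subset\mathbb S^{n-1}$ with $|C|=N$. For a real polynomial $f$ let $$f_0=\frac{\Gamma(n-1)}{2^{n-2}\Gamma(\frac{n-1}2)^2}\int_{-1}^1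 f(t)(1-t^2)^{\frac{n-3}2}\,dt .$$ There are unique reals $-1<\alpha_0<\dots<\alpha_{k-1}<1$ and $\rho_0,\dots,\rho_{k-1}>0$ such that $f_0=\frac{f(1)}N+\sum_{i=0}^{k-1}\rho_i f(\alpha_i)$ for every real polynomial $f$ of degree at most $2k-1$. With these numbers, let $\alpha_{k-1}<u<1$. For each $j\in\{0,\dots,k-1\}$ there is a unique polynomial $G=G_{j,u}$ of degree at most $2k-1$ with $$G(\alpha_i)=h(\alpha_i),\quad G'(\alpha_i)=h'(\alpha_i)\quad(i\ne j),\qquad G(-1)=h(-1),\qquad G(u)=h(u),$$ and, for each $j$, every spherical $\tau$-design $C\subset\mathbb S^{n-1}$ with $|C|=N$ and $u(C)\le u$ satisfies $$E(n,C;h)\le N\bigl(G_0N-G(1)\bigr)=N^2\sum_{i=0}^{k-1}\rho_i h(\alpha_i)+N^2\rho_j\bigl[G(\alpha_j)-h(\alpha_j)\bigr],$$ where $G_0$ is $f_0$ for $f=G$; the equality holds whether or not such a $C$ exists. If moreover $u(n,N,\tau)\le u$ (in particular for $u=u(n,N,\tau)$, when $\alpha_{k-1}<u(n,N,\tau)<1$),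 then $$\mathcal U(n,N,\tau;h)-\mathcal L(n,N,\tau;h)\le N^2\min_{0\le j\le k-1}\rho_j\bigl[G_{j,u}(\alpha_j)-h(\alpha_j)\bigr].$$ (If there is no $\tau$-design with $N$ points, the last claim is void.) -/

import Mathlib

open scoped ENNReal

noncomputable section

/-- The unit sphere `S^{n-1}` of `ℝⁿ`. -/
abbrev UnitSphere (n : ℕ) : Type := Metric.sphere (0 : EuclideanSpace ℝ (Fin n)) 1

/-- The inner product of two points of the sphere. -/
def sphereInner {n : ℕ} (x y : UnitSphere n) : ℝ :=
  inner ℝ (x : EuclideanSpace ℝ (Fin n)) (y : EuclideanSpace ℝ (Fin n))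

/-- The surface area measure of the unit sphere. -/
def surfaceMeasure (n : ℕ) : MeasureTheory.Measure (UnitSphere n) :=
  (MeasureTheory.volume : MeasureTheory.Measure (EuclideanSpace ℝ (Fin n))).toSphere

/-- A spherical `τ`-design: a nonempty finite subset of the sphere whose average of every polynomial
of total degree at most `τ` is the average of that polynomial over the whole sphere. -/
def IsSphericalDesign {n : ℕ} (τ : ℕ) (C : Finset (UnitSphere n)) : Prop :=
  C.Nonempty ∧ ∀ f : MvPolynomial (Fin n) ℝ, f.totalDegree ≤ τ →
    ((surfaceMeasure n).real Set.univ)⁻¹ *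
        ∫ x, MvPolynomial.eval (fun i => (x : EuclideanSpace ℝ (Fin n)) i) f ∂(surfaceMeasure n) =
      (C.card : ℝ)⁻¹ *
        ∑ x ∈ C, MvPolynomial.eval (fun i => (x : EuclideanSpace ℝ (Fin n)) i) f

open Classical in
/-- The `h`-energy `E(n, C; h)`: the sum of `h (⟨x, y⟩)` over ordered pairs of distinct points. -/
def designEnergy {n : ℕ} (h : ℝ → ℝ≥0∞) (C : Finset (UnitSphere n)) : ℝ≥0∞ :=
  ∑ p ∈ C.offDiag, h (sphereInner p.1 p.2)

/-- `ℒ(n, N, τ; h)`: the infimum of the energies of the `τ`-designs with `N` points. -/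
def energyInf (n N τ : ℕ) (h : ℝ → ℝ≥0∞) : ℝ≥0∞ :=
  ⨅ C : {C : Finset (UnitSphere n) // IsSphericalDesign τ C ∧ C.card = N}, designEnergy h C.1

/-- `𝒰(n, N, τ; h)`: the supremum of the energies of the `τ`-designs with `N` points. -/
def energySup (n N τ : ℕ) (h : ℝ → ℝ≥0∞) : ℝ≥0∞ :=
  ⨆ C : {C : Finset (UnitSphere n) // IsSphericalDesign τ C ∧ C.card = N}, designEnergy h C.1

/-- `u(C)`: the largest inner product of two distinct points of `C` (the set below is finite, and
nonempty as soon as `C` has two points, so that the supremum is then a maximum). -/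
def maxInner {n : ℕ} (C : Finset (UnitSphere n)) : ℝ :=
  sSup {t : ℝ | ∃ x ∈ C, ∃ y ∈ C, x ≠ y ∧ sphereInner x y = t}

/-- `u(n, N, τ)`: the supremum of `u(C)` over the `τ`-designs `C` with `N` points. -/
def maxInnerSup (n N τ : ℕ) : ℝ :=
  sSup {t : ℝ | ∃ C : Finset (UnitSphere n), IsSphericalDesign τ C ∧ C.card = N ∧ maxInner C = t}

/-- The Delsarte-Goethals-Seidel number `D(n, τ)`, for `n, τ ≥ 1`: it is
`2 * choose (n + k - 2) (n - 1)` for `τ = 2 * k - 1`, and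
`choose (n + k - 1) (n - 1) + choose (n + k - 2) (n - 1)` for `τ = 2 * k`. -/
def dgsBound (n τ : ℕ) : ℕ :=
  if Even τ then
    (n + τ / 2 - 1).choose (n - 1) + (n + τ / 2 - 2).choose (n - 1)
  else
    2 * (n + (τ + 1) / 2 - 2).choose (n - 1)

/-- Absolutely monotone potentials: `h` is finite and infinitely differentiable on `[-1, 1)`, and all
its derivatives (one-sided at `-1`), including the zeroth, are nonnegative there. The value `h 1` is
arbitrary and may be infinite. -/
def IsAbsolutelyMonotone (h : ℝ → ℝ≥0∞) : Prop :=
  (∀ t ∈ Set.Ico (-1 : ℝ) 1, h t ≠ ∞) ∧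
  ContDiffOn ℝ ((⊤ : ℕ∞) : WithTop ℕ∞) (fun t => (h t).toReal) (Set.Ico (-1) 1) ∧
  ∀ m : ℕ, ∀ t ∈ Set.Ico (-1 : ℝ) 1,
    0 ≤ iteratedDerivWithin m (fun s => (h s).toReal) (Set.Ico (-1) 1) t

/-- The constant Gegenbauer coefficient `f₀` of a real polynomial `f` in dimension `n ≥ 2`. -/
def gegenbauerZero (n : ℕ) (f : Polynomial ℝ) : ℝ :=
  Real.Gamma ((n : ℝ) - 1) / ((2 : ℝ) ^ ((n : ℝ) - 2) * Real.Gamma (((n : ℝ) - 1) / 2) ^ 2) *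
    ∫ t in (-1 : ℝ)..1, f.eval t * (1 - t ^ 2) ^ (((n : ℝ) - 3) / 2)

/-- The quadrature that determines the nodes `α` and the weights `ρ`: the nodes increase and lie in
`(-1, 1)`, the weights are positive, and `f₀ = f(1) / N + ∑ ρᵢ f(αᵢ)` for all polynomials `f` of
degree at most `2 * k - 1`. -/
structure IsDesignQuadrature (n N k : ℕ) (α ρ : Fin k → ℝ) : Prop where
  strictMono : StrictMono α
  neg_one_lt : ∀ i, -1 < α i
  lt_one : ∀ i, α i < 1
  weight_pos : ∀ i, 0 < ρ i
  quadrature : ∀ f : Polynomial ℝ, f.natDegree ≤ 2 * k - 1 →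
    gegenbauerZero n f = f.eval 1 / N + ∑ i, ρ i * f.eval (α i)

/-- `G` is the Hermite interpolant `G_{j,u}` of `h`: it has degree at most `2 * k - 1`, agrees with
`h` to first order at each `α i`, `i ≠ j`, and agrees with `h` at `-1` and at `u`. -/
structure IsHermiteInterpolant {k : ℕ} (h : ℝ → ℝ≥0∞) (α : Fin k → ℝ) (j : Fin k) (u : ℝ)
    (G : Polynomial ℝ) : Prop where
  natDegree_le : G.natDegree ≤ 2 * k - 1
  eval_node : ∀ i, i ≠ j → G.eval (α i) = (h (α i)).toReal
  deriv_node : ∀ i, i ≠ j → G.derivative.eval (α i) = deriv (fun t => (h t).toReal) (α i)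
  eval_neg_one : G.eval (-1) = (h (-1)).toReal
  eval_u : G.eval u = (h u).toReal

end

/-! For a `(2 * k - 1)`-design with N points, a polynomial potential f of degree at most 2k-1 has an
energy independent of the design. Each point sees the total N f₀, and removing the diagonal costs
f(1) per point, so the energy is N(f₀N - f(1)). The quadrature rewrites this as N² ∑ ρᵢ f(αᵢ).
Bounding h by such polynomials on the possible inner products therefore bounds the energy.

The polynomials are Hermite interpolants with 2k conditions. Their error is h⁽²ᵏ⁾(ξ)/(2k)! times the
monic nodal polynomial, so by absolute monotonicity it has the sign of the latter. With all αᵢ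
doubled the nodal polynomial is a square, and the interpolant lies below h: this gives the lower
bound N² ∑ ρᵢ h(αᵢ). Replacing the double node αⱼ by simple nodes -1 and u introduces the factor (t
+ 1)(t - u), nonpositive on [-1, u], and G lies above h there. Since G agrees with h at every αᵢ
except αⱼ, the two bounds differ by the j-th term alone (`IsHermiteInterpolant.energy_eq`).

The quadrature is the Gauss quadrature of Λf = f₀ - f(1)/N. It exists with nodes inside (-1, 1) once
Λ((1 ± X)f²) > 0 for nonzero f of degree below k (`existsUnique_gaussQuadrature`). The factor 1 - X
kills the mass at 1. For 1 + X one needs the sharp bound on f(1)² by the norm of f, attained by a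
Gegenbauer polynomial (`sq_eval_one_le`); its constant makes D(n, 2k-1) < N exactly the right
condition.

Finally, f₀ must be the spherical mean of f(⟨x, ·⟩). Both functionals satisfy the same Pearson
equation, which determines all moments: one by integrating by parts on [-1, 1], the other through
Gaussian integrals on ℝⁿ. -/

section lemmas

open Polynomial

/-! ### Orthogonal polynomials and Gauss quadrature -/

/-- Positive definiteness of a linear functional on squares, with weight `w`. -/
def PosOnSquares (Λ : ℝ[X] →ₗ[ℝ] ℝ) (w : ℝ[X]) (k : ℕ) : Prop :=
  ∀ f : ℝ[X], f ≠ 0 → f.natDegree < k → 0 < Λ (w * f ^ 2)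

/-- A Gauss quadrature formula with `k` nodes in `(-1, 1)` for the functional `Λ`. -/
structure IsGaussQuadrature (Λ : ℝ[X] →ₗ[ℝ] ℝ) (k : ℕ) (α ρ : Fin k → ℝ) : Prop where
  strictMono : StrictMono α
  neg_one_lt : ∀ i, -1 < α i
  lt_one : ∀ i, α i < 1
  weight_pos : ∀ i, 0 < ρ i
  quadrature : ∀ f : ℝ[X], f.natDegree ≤ 2 * k - 1 → Λ f = ∑ i, ρ i * f.eval (α i)

/-- The monic orthogonal polynomial of degree `k`. -/
def IsMonicOrthogonal (Λ : ℝ[X] →ₗ[ℝ] ℝ) (k : ℕ) (P : ℝ[X]) : Prop :=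
  P.Monic ∧ P.natDegree = k ∧ ∀ r : ℝ[X], r.natDegree < k → Λ (P * r) = 0

theorem natDegree_lt_of_mem_degreeLT {k : ℕ} (hk : 1 ≤ k) {f : ℝ[X]}
    (hf : f ∈ degreeLT ℝ k) : f.natDegree < k := by
  by_cases h0 : f = 0
  · simp [h0]; omega
  · exact (natDegree_lt_iff_degree_lt h0).2 (mem_degreeLT.1 hf)

theorem mem_degreeLT_of_natDegree_lt {k : ℕ} {f : ℝ[X]} (hf : f.natDegree < k) :
    f ∈ degreeLT ℝ k := by
  by_cases h0 : f = 0
  · simp [h0]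
  · exact mem_degreeLT.2 ((natDegree_lt_iff_degree_lt h0).1 hf)

theorem PosOnSquares.one_of_add {Λ : ℝ[X] →ₗ[ℝ] ℝ} {k : ℕ} (hp : PosOnSquares Λ (1 + X) k)
    (hm : PosOnSquares Λ (1 - X) k) : PosOnSquares Λ 1 k := by
  intro f hf hd
  have h1 := hp f hf hd
  have h2 := hm f hf hd
  have h3 : (1 + X) * f ^ 2 + (1 - X) * f ^ 2 = (2 : ℝ) • (1 * f ^ 2) := by
    rw [smul_eq_C_mul]; simp only [map_ofNat]; ring
  have h4 := congrArg Λ h3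
  rw [map_add, map_smul, smul_eq_mul] at h4
  linarith

/-- Positivity makes (f, g) ↦ Λ(fg) nondegenerate in degree below k, so the functional r ↦ Λ(Xᵏr) is
represented by some s; then Xᵏ - s is orthogonal. -/
theorem exists_monicOrthogonal {Λ : ℝ[X] →ₗ[ℝ] ℝ} {k : ℕ} (hk : 1 ≤ k)
    (h : PosOnSquares Λ 1 k) : ∃ P, IsMonicOrthogonal Λ k P := by
  let B : degreeLT ℝ k →ₗ[ℝ] Module.Dual ℝ (degreeLT ℝ k) :=
    LinearMap.mk₂ ℝ (fun f g => Λ ((f : ℝ[X]) * g))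
      (by intros; simp [add_mul]) (by intros; simp) (by intros; simp [mul_add])
      (by intros; simp)
  have hB : Function.Injective B := by
    rw [injective_iff_map_eq_zero]
    intro f hf
    by_contra hne
    have h1 := h f (by simpa using hne) (natDegree_lt_of_mem_degreeLT hk f.2)
    have h2 : B f f = 0 := by rw [hf]; rfl
    have h3 : Λ ((f : ℝ[X]) * f) = 0 := h2
    rw [one_mul, sq, h3] at h1
    exact lt_irrefl _ h1
  have hfin : FiniteDimensional ℝ (degreeLT ℝ k) :=
    Module.Finite.equiv (degreeLTEquiv ℝ k).symm
  have hsurj : Function.Surjective B :=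
    (LinearMap.injective_iff_surjective_of_finrank_eq_finrank
      (Subspace.dual_finrank_eq (K := ℝ) (V := degreeLT ℝ k)).symm).1 hB
  let φ : Module.Dual ℝ (degreeLT ℝ k) :=
    (Λ ∘ₗ LinearMap.mulLeft ℝ (X ^ k : ℝ[X])) ∘ₗ (degreeLT ℝ k).subtype
  obtain ⟨s, hs⟩ := hsurj φ
  have hsd : (s : ℝ[X]).degree < (k : ℕ) := mem_degreeLT.1 s.2
  refine ⟨X ^ k - (s : ℝ[X]), monic_X_pow_sub hsd, ?_, ?_⟩
  · rw [natDegree_sub_eq_left_of_natDegree_lt]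
    · simp
    · simpa using natDegree_lt_of_mem_degreeLT hk s.2
  · intro r hr
    have h1 := LinearMap.congr_fun hs ⟨r, mem_degreeLT_of_natDegree_lt hr⟩
    have h2 : Λ ((s : ℝ[X]) * r) = Λ (X ^ k * r) := h1
    rw [sub_mul, map_sub, h2, sub_self]

theorem IsMonicOrthogonal.unique {Λ : ℝ[X] →ₗ[ℝ] ℝ} {k : ℕ}
    (h : PosOnSquares Λ 1 k) {P Q : ℝ[X]} (hP : IsMonicOrthogonal Λ k P)
    (hQ : IsMonicOrthogonal Λ k Q) : P = Q := by
  by_contra hne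
  have hd : (P - Q).natDegree < k := by
    have h1 : (P - Q).degree < P.degree :=
      degree_sub_lt_left (by rw [degree_eq_natDegree hP.1.ne_zero, degree_eq_natDegree hQ.1.ne_zero,
        hP.2.1, hQ.2.1]) hP.1.ne_zero (by rw [hP.1, hQ.1])
    rw [← hP.2.1]
    exact natDegree_lt_natDegree (sub_ne_zero.2 hne) h1
  have h1 := h _ (sub_ne_zero.2 hne) hd
  rw [one_mul, sq, sub_mul, map_sub, hP.2.2 _ hd, hQ.2.2 _ hd, sub_zero] at h1
  exact lt_irrefl _ h1

section roots

variable {Λ : ℝ[X] →ₗ[ℝ] ℝ} {k : ℕ} {P : ℝ[X]}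

/-- A monic quadratic without distinct real roots cannot divide an orthogonal polynomial. -/
theorem IsMonicOrthogonal.not_quadratic_dvd (h : PosOnSquares Λ 1 k)
    (hP : IsMonicOrthogonal Λ k P) (a b : ℝ) : ¬ (X - C a) ^ 2 + C (b ^ 2) ∣ P := by
  rintro ⟨R, hR⟩
  have hR0 : R ≠ 0 := by rintro rfl; exact hP.1.ne_zero (by simpa using hR)
  have hq : ((X - C a) ^ 2 + C (b ^ 2)).natDegree = 2 := by
    rw [natDegree_add_C, natDegree_pow, natDegree_X_sub_C]
  have hq0 : (X - C a) ^ 2 + C (b ^ 2) ≠ 0 := by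
    intro h0; rw [h0] at hq; simp at hq
  have hd : k = 2 + R.natDegree := by
    rw [← hP.2.1, hR, natDegree_mul hq0 hR0, hq]
  have h1 := hP.2.2 R (by omega)
  have hXa : (X - C a) * R ≠ 0 := mul_ne_zero (X_sub_C_ne_zero a) hR0
  have h2 := h ((X - C a) * R) hXa (by
    rw [natDegree_mul (X_sub_C_ne_zero a) hR0, natDegree_X_sub_C]; omega)
  have h3 := h R hR0 (by omega)
  -- P is orthogonal to the cofactor R of degree k - 2, yet PR is a nonzero square plus b² times a
  -- square, on which Λ is positive.
  have h4 : P * R = 1 * ((X - C a) * R) ^ 2 + (b ^ 2) • (1 * R ^ 2) := by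
    rw [hR, smul_eq_C_mul]; ring
  rw [h4, map_add, map_smul, smul_eq_mul] at h1
  nlinarith [mul_nonneg (sq_nonneg b) h3.le]

/-- For P = (X - a)R, orthogonality to R gives Λ(XR²) = aΛ(R²). Hence (1 ± a)Λ(R²) = Λ((1 ± X)R²) >
0. -/
theorem IsMonicOrthogonal.root_mem (hp : PosOnSquares Λ (1 + X) k)
    (hm : PosOnSquares Λ (1 - X) k) (hP : IsMonicOrthogonal Λ k P) {a : ℝ} (ha : P.IsRoot a) :
    a ∈ Set.Ioo (-1 : ℝ) 1 := by
  have h := hp.one_of_add hm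
  obtain ⟨R, hR⟩ := dvd_iff_isRoot.2 ha
  have hR0 : R ≠ 0 := by rintro rfl; exact hP.1.ne_zero (by simpa using hR)
  have hd : k = 1 + R.natDegree := by
    rw [← hP.2.1, hR, natDegree_mul (X_sub_C_ne_zero a) hR0, natDegree_X_sub_C]
  have h1 := hP.2.2 R (by omega)
  have h2 := h R hR0 (by omega)
  have h3 := hp R hR0 (by omega)
  have h4 := hm R hR0 (by omega)
  have h5 : P * R = (1 + X) * R ^ 2 - (1 + a) • (1 * R ^ 2) := by
    rw [hR, smul_eq_C_mul]; simp only [map_add, map_one]; ring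
  have h6 : P * R = (1 - a) • (1 * R ^ 2) - (1 - X) * R ^ 2 := by
    rw [hR, smul_eq_C_mul]; simp only [map_sub, map_one]; ring
  have h7 := h1
  rw [h5, map_sub, map_smul, smul_eq_mul] at h1
  rw [h6, map_sub, map_smul, smul_eq_mul] at h7
  constructor
  · by_contra! hc; nlinarith
  · by_contra! hc; nlinarith

theorem IsMonicOrthogonal.nodup_roots (h : PosOnSquares Λ 1 k)
    (hP : IsMonicOrthogonal Λ k P) : P.roots.Nodup := by
  rw [Multiset.nodup_iff_count_le_one]
  intro a
  rw [count_roots]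
  by_contra! hc
  have h1 : (X - C a) ^ 2 ∣ P := (le_rootMultiplicity_iff hP.1.ne_zero).1 hc
  exact hP.not_quadratic_dvd h a 0 (by simpa using h1)

/-- A rootless factor Q of positive degree would have a nonreal complex root, hence a real quadratic
factor (X - a)² + b² of P, which is excluded. -/
theorem IsMonicOrthogonal.card_roots (h : PosOnSquares Λ 1 k)
    (hP : IsMonicOrthogonal Λ k P) : P.roots.card = k := by
  obtain ⟨Q, hQ, hcard, hroots⟩ := exists_prod_multiset_X_sub_C_mul P
  have hQ0 : Q ≠ 0 := by rintro rfl; exact hP.1.ne_zero (by simpa using hQ.symm)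
  by_contra hne
  have hdeg : Q.natDegree ≠ 0 := by
    rw [hP.2.1] at hcard; omega
  obtain ⟨z, hz⟩ := IsAlgClosed.exists_aeval_eq_zero ℂ Q (by
    rw [degree_eq_natDegree hQ0]; exact_mod_cast hdeg)
  by_cases hzi : z.im = 0
  · have hzr : z = (algebraMap ℝ ℂ) z.re := by
      apply Complex.ext <;> simp [hzi]
    rw [hzr, aeval_algebraMap_apply] at hz
    have : Q.IsRoot z.re := by simpa using hz
    have : z.re ∈ Q.roots := (mem_roots hQ0).2 this
    rw [hroots] at this
    simp at this
  · have h2 := Polynomial.quadratic_dvd_of_aeval_eq_zero_im_ne_zero Q hz hzi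
    apply hP.not_quadratic_dvd h z.re z.im
    have h3 : (X - C z.re) ^ 2 + C (z.im ^ 2) = X ^ 2 - C (2 * z.re) * X + C (‖z‖ ^ 2) := by
      rw [Complex.sq_norm, Complex.normSq_apply]
      simp only [map_add, map_mul, map_pow, map_ofNat]; ring
    rw [h3]
    exact h2.trans (Dvd.intro_left _ hQ)

end roots

/-- Exactness up to degree 2k - 1 covers the product of the nodal polynomial with any r of degree
below k. This is what makes the nodes unique. -/
theorem isMonicOrthogonal_nodal {Λ : ℝ[X] →ₗ[ℝ] ℝ} {k : ℕ} {α ρ : Fin k → ℝ}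
    (h : IsGaussQuadrature Λ k α ρ) : IsMonicOrthogonal Λ k (∏ i, (X - C (α i))) := by
  have hd : (∏ i, (X - C (α i))).natDegree = k := by
    rw [natDegree_prod_of_monic _ _ fun i _ => monic_X_sub_C _]; simp
  refine ⟨monic_prod_of_monic _ _ fun i _ => monic_X_sub_C _, hd, fun r hr => ?_⟩
  rw [h.quadrature _ (natDegree_mul_le.trans (by omega))]
  refine Finset.sum_eq_zero fun i _ => ?_
  rw [eval_mul, eval_prod, Finset.prod_eq_zero (Finset.mem_univ i) (by simp)]
  simp

/-- Existence and uniqueness of the Gauss quadrature of a functional that is positive definite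
together with its two modifications by `1 + X` and `1 - X`. -/
theorem existsUnique_gaussQuadrature {Λ : ℝ[X] →ₗ[ℝ] ℝ} {k : ℕ} (hk : 1 ≤ k)
    (hp : PosOnSquares Λ (1 + X) k) (hm : PosOnSquares Λ (1 - X) k) :
    ∃! q : (Fin k → ℝ) × (Fin k → ℝ), IsGaussQuadrature Λ k q.1 q.2 := by
  have h := hp.one_of_add hm
  obtain ⟨P, hP⟩ := exists_monicOrthogonal hk h
  have hcard : P.roots.toFinset.card = k := by
    rw [Multiset.toFinset_card_of_nodup (hP.nodup_roots h), hP.card_roots h]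
  let α : Fin k → ℝ := P.roots.toFinset.orderEmbOfFin hcard
  have hα : StrictMono α := (P.roots.toFinset.orderEmbOfFin hcard).strictMono
  have hroot : ∀ i, P.IsRoot (α i) := fun i => by
    have := P.roots.toFinset.orderEmbOfFin_mem hcard i
    exact (mem_roots hP.1.ne_zero).1 (Multiset.mem_toFinset.1 this)
  have hinj : Set.InjOn α (Finset.univ : Finset (Fin k)) := hα.injective.injOn
  -- The only possible weights: the quadrature applied to the Lagrange basis.
  let ρ : Fin k → ℝ := fun i => Λ (Lagrange.basis Finset.univ α i)
  have hbd : ∀ i, (Lagrange.basis Finset.univ α i).natDegree = k - 1 := fun i =>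
    natDegree_eq_of_degree_eq_some (by
      rw [Lagrange.degree_basis hinj (Finset.mem_univ i)]; simp)
  have hlow : ∀ r : ℝ[X], r.natDegree < k → Λ r = ∑ i, ρ i * r.eval (α i) := fun r hr => by
    have h1 : r = Lagrange.interpolate Finset.univ α fun i => r.eval (α i) :=
      Lagrange.eq_interpolate hinj (by
        have := mem_degreeLT.1 (mem_degreeLT_of_natDegree_lt hr)
        simpa using this)
    conv_lhs => rw [h1]
    rw [Lagrange.interpolate_apply, map_sum]
    refine Finset.sum_congr rfl fun i _ => ?_
    rw [← smul_eq_C_mul, map_smul, smul_eq_mul, mul_comm]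
  have hquad : ∀ f : ℝ[X], f.natDegree ≤ 2 * k - 1 → Λ f = ∑ i, ρ i * f.eval (α i) :=
    fun f hf => by
    -- Gauss's argument: dividing by P leaves a quotient of degree below k, which Λ(P ·)
    -- annihilates, and a remainder with the same values at the nodes.
    have h1 := modByMonic_add_div f P
    have hr : (f %ₘ P).natDegree < k := by
      rw [← hP.2.1]
      exact natDegree_modByMonic_lt f hP.1 (by intro h1; have := hP.2.1; rw [h1] at this; simp at this; omega)
    have hq : (f /ₘ P).natDegree < k := by
      rw [natDegree_divByMonic f hP.1, hP.2.1]; omega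
    have h2 : Λ f = Λ (f %ₘ P) := by
      conv_lhs => rw [← h1]
      rw [map_add, hP.2.2 _ hq, add_zero]
    rw [h2, hlow _ hr]
    refine Finset.sum_congr rfl fun i _ => ?_
    have h3 : (f %ₘ P).eval (α i) = f.eval (α i) := by
      conv_rhs => rw [← h1]
      rw [eval_add, eval_mul, (hroot i : P.eval (α i) = 0)]; ring
    rw [h3]
  have hpos : ∀ i, 0 < ρ i := fun i => by
    -- The squared basis polynomial has degree 2k - 2, so the quadrature is exact for it and returns
    -- ρᵢ.
    have h1 := h _ (Lagrange.basis_ne_zero hinj (Finset.mem_univ i)) (by rw [hbd i]; omega)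
    rw [one_mul, hquad _ (by rw [natDegree_pow, hbd i]; omega),
      Finset.sum_eq_single i (fun j _ hj => by
        rw [eval_pow, Lagrange.eval_basis_of_ne hj.symm (Finset.mem_univ j)]; simp) (by simp),
      eval_pow, Lagrange.eval_basis_self hinj (Finset.mem_univ i)] at h1
    simpa using h1
  have hG : IsGaussQuadrature Λ k α ρ :=
    ⟨hα, fun i => (hP.root_mem hp hm (hroot i)).1, fun i => (hP.root_mem hp hm (hroot i)).2,
      hpos, hquad⟩
  refine ⟨(α, ρ), hG, ?_⟩
  rintro ⟨β, σ⟩ hβ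
  have hβ' : IsGaussQuadrature Λ k β σ := hβ
  have h1 : (∏ i, (X - C (β i))) = ∏ i, (X - C (α i)) :=
    (isMonicOrthogonal_nodal hβ').unique h (isMonicOrthogonal_nodal hG)
  have hrange : Set.range β = Set.range α := by
    ext x
    have h2 := congrArg (eval x) h1
    simp only [eval_prod, eval_sub, eval_X, eval_C] at h2
    have h3 : (∏ i, (x - β i)) = 0 ↔ (∏ i, (x - α i)) = 0 := by rw [h2]
    simp only [Finset.prod_eq_zero_iff, Finset.mem_univ, true_and, sub_eq_zero] at h3
    simpa [Set.mem_range, eq_comm] using h3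
  have hβα : β = α := (hβ'.strictMono.range_inj hα).1 hrange
  subst hβα
  refine Prod.ext rfl (funext fun i => ?_)
  change σ i = Λ _
  rw [hβ'.quadrature _ (by rw [hbd i]; omega),
      Finset.sum_eq_single i (fun j _ hj => by
        rw [Lagrange.eval_basis_of_ne hj.symm (Finset.mem_univ j)]; simp) (by simp),
      Lagrange.eval_basis_self hinj (Finset.mem_univ i), mul_one]

/-! ### The Pearson equation and Gegenbauer polynomials -/

/-- The linear functionals on polynomials satisfying the Pearson equation of the weight
`(1 - t ^ 2) ^ ((n - 3) / 2)`, normalized by `L 1 = 1`. -/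
structure IsZonalFunctional (n : ℕ) (L : ℝ[X] →ₗ[ℝ] ℝ) : Prop where
  map_one : L 1 = 1
  pearson : ∀ p : ℝ[X], L ((1 - X ^ 2) * derivative p) = ((n : ℝ) - 1) * L (X * p)

/-- The Gegenbauer polynomials with parameter `n / 2`. -/
noncomputable def gegenbauerPoly (n : ℕ) : ℕ → ℝ[X]
  | 0 => 1
  | 1 => C (n : ℝ) * X
  | m + 2 => C ((2 * m + 2 + n) / (m + 2) : ℝ) * (X * gegenbauerPoly n (m + 1)) -
      C ((m + n) / (m + 2) : ℝ) * gegenbauerPoly n m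

theorem gegenbauerPoly_rec (n m : ℕ) :
    C (m + 2 : ℝ) * gegenbauerPoly n (m + 2) =
      C (2 * m + 2 + n : ℝ) * (X * gegenbauerPoly n (m + 1)) -
        C (m + n : ℝ) * gegenbauerPoly n m := by
  have h : (m + 2 : ℝ) ≠ 0 := by positivity
  have h1 : ∀ a : ℝ, C (m + 2 : ℝ) * C (a / (m + 2)) = C a := fun a => by
    rw [← C_mul, mul_div_cancel₀ _ h]
  rw [gegenbauerPoly, mul_sub, ← mul_assoc, h1, ← mul_assoc (C (m + 2 : ℝ)), h1]

theorem natDegree_gegenbauerPoly_le (n : ℕ) : ∀ m, (gegenbauerPoly n m).natDegree ≤ m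
  | 0 => by simp [gegenbauerPoly]
  | 1 => by
    rw [gegenbauerPoly]
    exact (natDegree_C_mul_le _ _).trans natDegree_X_le
  | m + 2 => by
    rw [gegenbauerPoly]
    refine (natDegree_sub_le _ _).trans (max_le ?_ ?_)
    · refine (natDegree_C_mul_le _ _).trans (natDegree_mul_le.trans ?_)
      have := natDegree_gegenbauerPoly_le n (m + 1)
      rw [natDegree_X]; omega
    · exact (natDegree_C_mul_le _ _).trans ((natDegree_gegenbauerPoly_le n m).trans (by omega))

/-- The two identities are proved together: differentiating the three-term recurrence and using the
first identity yields the next second one, from which the next first one follows. -/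
theorem gegenbauerPoly_derivative (n m : ℕ) :
    X * derivative (gegenbauerPoly n (m + 1)) - derivative (gegenbauerPoly n m) =
        C (m + 1 : ℝ) * gegenbauerPoly n (m + 1) ∧
      derivative (gegenbauerPoly n (m + 1)) - X * derivative (gegenbauerPoly n m) =
        C (m + n : ℝ) * gegenbauerPoly n m := by
  induction m with
  | zero => simp [gegenbauerPoly]; ring
  | succ m ih =>
    obtain ⟨hA, hB⟩ := ih
    have hr := gegenbauerPoly_rec n m
    have hd := congrArg derivative hr
    have h0 : (C (m + 2 : ℝ)) ≠ 0 := by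
      rw [Ne, C_eq_zero]; positivity
    simp only [derivative_C_mul, derivative_sub] at hd
    simp only [derivative_mul, derivative_X, one_mul] at hd
    simp only [map_add, map_mul, map_natCast, map_one, map_ofNat] at *
    have hB' : derivative (gegenbauerPoly n (m + 2)) - X * derivative (gegenbauerPoly n (m + 1)) =
        ((m : ℝ[X]) + 1 + (n : ℝ[X])) * gegenbauerPoly n (m + 1) := by
      apply mul_left_cancel₀ h0
      linear_combination hd + ((m : ℝ[X]) + (n : ℝ[X])) * hA
    push_cast
    constructor
    · linear_combination X * hB' - hB + X * hA - hr
    · exact hB'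

theorem gegenbauerPoly_raise (n m : ℕ) :
    C (m + 1 : ℝ) * gegenbauerPoly n (m + 1) = C (m + n : ℝ) * (X * gegenbauerPoly n m) -
      (1 - X ^ 2) * derivative (gegenbauerPoly n m) := by
  obtain ⟨hA, hB⟩ := gegenbauerPoly_derivative n m
  linear_combination X * hB - hA

theorem eval_one_gegenbauerPoly {n : ℕ} (hn : 1 ≤ n) (m : ℕ) :
    (gegenbauerPoly n m).eval 1 = ((n + m - 1).choose m : ℝ) := by
  induction m with
  | zero => simp [gegenbauerPoly]
  | succ m ih =>
    have h := congrArg (eval 1) (gegenbauerPoly_raise n m)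
    simp only [eval_mul, eval_C, eval_sub, eval_X, eval_one, eval_pow, one_pow, sub_self,
      zero_mul, sub_zero, one_mul, ih] at h
    obtain ⟨n, rfl⟩ : ∃ l, n = l + 1 := ⟨n - 1, by omega⟩
    have h1 := Nat.add_one_mul_choose_eq (n + m) m
    have e1 : n + 1 + m - 1 = n + m := by omega
    have e2 : n + 1 + (m + 1) - 1 = n + m + 1 := by omega
    rw [e1] at h
    rw [e2]
    have h2 : ((n + m + 1 : ℕ) : ℝ) * ((n + m).choose m : ℝ) =
      ((n + m + 1).choose (m + 1) : ℝ) * ((m + 1 : ℕ) : ℝ) := by exact_mod_cast h1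
    push_cast at h h2
    have h3 : (m + 1 : ℝ) ≠ 0 := by positivity
    apply mul_left_cancel₀ h3
    linarith

namespace IsZonalFunctional

variable {n : ℕ} {L : ℝ[X] →ₗ[ℝ] ℝ}

theorem map_C_mul (L : ℝ[X] →ₗ[ℝ] ℝ) (a : ℝ) (p : ℝ[X]) : L (C a * p) = a * L p := by
  rw [← smul_eq_C_mul, map_smul, smul_eq_mul]

theorem map_X_pow_succ (h : IsZonalFunctional n L) (m : ℕ) :
    (m + n : ℝ) * L (X ^ (m + 2)) = (m + 1) * L (X ^ m) := by
  have h1 := h.pearson (X ^ (m + 1))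
  rw [derivative_X_pow, Nat.add_sub_cancel] at h1
  have e1 : (1 - X ^ 2 : ℝ[X]) * (C ((m + 1 : ℕ) : ℝ) * X ^ m) =
      C ((m + 1 : ℕ) : ℝ) * (X ^ m - X ^ (m + 2)) := by ring
  have e2 : (X : ℝ[X]) * X ^ (m + 1) = X ^ (m + 2) := by ring
  rw [e1, e2, map_C_mul, map_sub] at h1
  push_cast at h1
  linarith

theorem map_X (h : IsZonalFunctional n L) (hn : 2 ≤ n) : L X = 0 := by
  have h1 := h.pearson 1
  have h2 : (2 : ℝ) ≤ n := by exact_mod_cast hn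
  simp only [derivative_one, mul_zero, map_zero, mul_one] at h1
  rcases mul_eq_zero.1 h1.symm with h3 | h3
  · linarith
  · exact h3

theorem map_X_pow_odd (h : IsZonalFunctional n L) (hn : 2 ≤ n) (i : ℕ) :
    L (X ^ (2 * i + 1)) = 0 := by
  induction i with
  | zero => simpa using h.map_X hn
  | succ i ih =>
    have h1 := h.map_X_pow_succ (2 * i + 1)
    rw [ih, mul_zero] at h1
    have h2 : ((2 * i + 1 : ℕ) + n : ℝ) ≠ 0 := by positivity
    exact (mul_eq_zero.1 h1).resolve_left h2

/-- A normalized functional satisfying the Pearson equation is determined by its moments. -/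
theorem unique (hn : 2 ≤ n) {L' : ℝ[X] →ₗ[ℝ] ℝ} (h : IsZonalFunctional n L)
    (h' : IsZonalFunctional n L') : L = L' := by
  have key : ∀ m, L (X ^ m) = L' (X ^ m) ∧ L (X ^ (m + 1)) = L' (X ^ (m + 1)) := by
    intro m
    induction m with
    | zero => simp [h.map_one, h'.map_one, h.map_X hn, h'.map_X hn]
    | succ m ih =>
      refine ⟨ih.2, ?_⟩
      have h1 := h.map_X_pow_succ m
      have h2 := h'.map_X_pow_succ m
      rw [ih.1, ← h2] at h1
      have h3 : (m + n : ℝ) ≠ 0 := by positivity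
      exact mul_left_cancel₀ h3 h1
  refine lhom_ext' fun m => LinearMap.ext_ring ?_
  simpa [← X_pow_eq_monomial] using (key m).1

/-- Multiplying the weight by 1 - t² raises the dimension parameter by 2. The Gegenbauer polynomials
above are orthogonal for this new weight. -/
theorem pearson_shift (h : IsZonalFunctional n L) (p : ℝ[X]) :
    L ((1 - X ^ 2) * ((1 - X ^ 2) * derivative p)) = (n + 1) * L ((1 - X ^ 2) * (X * p)) := by
  have h1 := h.pearson ((1 - X ^ 2) * p)
  have e1 : (1 - X ^ 2 : ℝ[X]) * derivative ((1 - X ^ 2) * p) =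
      (1 - X ^ 2) * ((1 - X ^ 2) * derivative p) - C 2 * ((1 - X ^ 2) * (X * p)) := by
    simp only [derivative_mul, derivative_sub, derivative_one, derivative_X_pow, map_ofNat,
      Nat.cast_ofNat]
    ring
  have e2 : X * ((1 - X ^ 2) * p) = (1 - X ^ 2) * (X * p) := by ring
  rw [e1, e2, map_sub, map_C_mul] at h1
  linarith

/-- Raising m by integration by parts leaves the terms (m - 1 - i)Xⁱ⁺¹ and i Xⁱ⁻¹ against the
polynomial of index m. For i + 1 < m the first vanishes by induction, for i + 1 = m by its
coefficient, and for i = m by parity, which is why the odd case is carried along. -/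
theorem map_gegenbauerPoly_mul_X_pow (h : IsZonalFunctional n L) (hn : 2 ≤ n) (m : ℕ) :
    ∀ i, (i < m ∨ Odd (i + m)) → L ((1 - X ^ 2) * (gegenbauerPoly n m * X ^ i)) = 0 := by
  induction m with
  | zero =>
    intro i hi
    obtain ⟨j, hj⟩ : Odd i := by simpa using hi
    have e : (1 - X ^ 2 : ℝ[X]) * (gegenbauerPoly n 0 * X ^ i) =
        X ^ (2 * j + 1) - X ^ (2 * (j + 1) + 1) := by
      rw [hj, gegenbauerPoly]; ring
    rw [e, map_sub, h.map_X_pow_odd hn, h.map_X_pow_odd hn, sub_zero]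
  | succ m ih =>
    intro i hi
    have h1 := h.pearson_shift (gegenbauerPoly n m * X ^ i)
    have h3 : C (m + 1 : ℝ) * ((1 - X ^ 2) * (gegenbauerPoly n (m + 1) * X ^ i)) =
        C (m + n : ℝ) * ((1 - X ^ 2) * (gegenbauerPoly n m * X ^ (i + 1))) -
        (1 - X ^ 2) * ((1 - X ^ 2) * derivative (gegenbauerPoly n m * X ^ i)) +
        C (i : ℝ) * ((1 - X ^ 2) * (gegenbauerPoly n m * X ^ (i - 1))) -
        C (i : ℝ) * ((1 - X ^ 2) * (gegenbauerPoly n m * X ^ (i + 1))) := by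
      have h2 := gegenbauerPoly_raise n m
      rcases i with _ | i
      · simp only [pow_zero, mul_one, Nat.cast_zero, map_zero, zero_mul, add_zero, sub_zero,
          zero_add, pow_one]
        linear_combination (1 - X ^ 2) * h2
      · rw [derivative_mul, derivative_X_pow, Nat.add_sub_cancel]
        linear_combination (1 - X ^ 2) * X ^ (i + 1) * h2
    have h4 := congrArg L h3
    have e2 : (X : ℝ[X]) * (gegenbauerPoly n m * X ^ i) = gegenbauerPoly n m * X ^ (i + 1) := by
      ring
    rw [e2] at h1
    rw [LinearMap.map_sub, LinearMap.map_add, LinearMap.map_sub, map_C_mul, map_C_mul, map_C_mul,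
      map_C_mul, h1] at h4
    have h5 : (m + 1 : ℝ) ≠ 0 := by positivity
    have h6 : (i : ℝ) * L ((1 - X ^ 2) * (gegenbauerPoly n m * X ^ (i - 1))) = 0 := by
      rcases i with _ | i
      · simp
      · rw [ih _ (by
          rcases hi with hi | ⟨j, hj⟩
          · left; omega
          · right; exact ⟨j - 1, by omega⟩), mul_zero]
    have h7 : ((m : ℝ) - 1 - i) * L ((1 - X ^ 2) * (gegenbauerPoly n m * X ^ (i + 1))) = 0 := by
      by_cases hc : i + 1 = m
      · have : (m : ℝ) = i + 1 := by exact_mod_cast hc.symm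
        rw [this]; ring
      · rw [ih _ (by
          rcases hi with hi | ⟨j, hj⟩
          · by_cases hc' : i = m
            · right; exact ⟨i, by omega⟩
            · left; omega
          · right; exact ⟨j, by omega⟩), mul_zero]
    apply (mul_eq_zero.1 (?_ : (m + 1 : ℝ) * _ = 0)).resolve_left h5
    rw [h4, h6]
    linarith

theorem map_gegenbauerPoly_mul (h : IsZonalFunctional n L) (hn : 2 ≤ n) {m : ℕ} {r : ℝ[X]}
    (hr : r = 0 ∨ r.natDegree < m) : L ((1 - X ^ 2) * (gegenbauerPoly n m * r)) = 0 := by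
  rcases hr with rfl | hr
  · simp
  rw [r.as_sum_range_C_mul_X_pow, Finset.mul_sum, Finset.mul_sum, map_sum]
  refine Finset.sum_eq_zero fun i hi => ?_
  have e : (1 - X ^ 2 : ℝ[X]) * (gegenbauerPoly n m * (C (r.coeff i) * X ^ i)) =
      C (r.coeff i) * ((1 - X ^ 2) * (gegenbauerPoly n m * X ^ i)) := by ring
  rw [e, map_C_mul, h.map_gegenbauerPoly_mul_X_pow hn m i
    (Or.inl (by have := Finset.mem_range.1 hi; omega)), mul_zero]

/-- Since (1 + X)X = (1 + X) - (1 - X²), the three-term recurrence propagates the value 1 once the 1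
- X² term is removed by orthogonality. Being of second order, it needs two consecutive indices in
the induction. -/
theorem map_one_add_X_mul_gegenbauerPoly (h : IsZonalFunctional n L) (hn : 2 ≤ n) (m : ℕ) :
    L ((1 + X) * gegenbauerPoly n m) = 1 := by
  have key : L ((1 + X) * gegenbauerPoly n m) = 1 ∧ L ((1 + X) * gegenbauerPoly n (m + 1)) = 1 := by
    induction m with
    | zero =>
      constructor
      · simp [gegenbauerPoly, h.map_one, h.map_X hn]
      · have e : (1 + X) * gegenbauerPoly n (0 + 1) = C (n : ℝ) * (X + X ^ 2) := by
          simp [gegenbauerPoly]; ring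
        have h1 := h.map_X_pow_succ 0
        rw [e, map_C_mul, map_add, h.map_X hn]
        simpa [h.map_one] using h1
    | succ m ih =>
      refine ⟨ih.2, ?_⟩
      have e : C (m + 2 : ℝ) * ((1 + X) * gegenbauerPoly n (m + 2)) =
          C (2 * m + 2 + n : ℝ) * ((1 + X) * gegenbauerPoly n (m + 1)) -
          C (2 * m + 2 + n : ℝ) * ((1 - X ^ 2) * (gegenbauerPoly n (m + 1) * 1)) -
          C (m + n : ℝ) * ((1 + X) * gegenbauerPoly n m) := by
        linear_combination (1 + X) * gegenbauerPoly_rec n m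
      have h1 := congrArg L e
      rw [LinearMap.map_sub, LinearMap.map_sub, map_C_mul, map_C_mul, map_C_mul, map_C_mul, ih.1, ih.2,
        h.map_gegenbauerPoly_mul hn (Or.inr (by simp))] at h1
      have h5 : (m + 2 : ℝ) ≠ 0 := by positivity
      apply mul_left_cancel₀ h5
      show (m + 2 : ℝ) * L ((1 + X) * gegenbauerPoly n (m + 2)) = _
      linarith
  exact key.1

/-- The Gegenbauer polynomial represents the evaluation at `1` for the weight `1 + X`. -/
theorem map_one_add_X_mul_mul_gegenbauerPoly (h : IsZonalFunctional n L) (hn : 2 ≤ n) {m : ℕ}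
    {f : ℝ[X]} (hf : f.natDegree ≤ m) : L ((1 + X) * (f * gegenbauerPoly n m)) = f.eval 1 := by
  -- With f - f(1) = (X - 1)r, the factor 1 + X turns the difference into -(1 - X²)r, orthogonal to
  -- the Gegenbauer polynomial because r has lower degree.
  obtain ⟨r, hr⟩ : X - C 1 ∣ f - C (f.eval 1) := by
    rw [dvd_iff_isRoot]; simp
  have hr' : r = 0 ∨ r.natDegree < m := by
    by_cases h0 : r = 0
    · exact Or.inl h0
    · right
      have h1 := congrArg natDegree hr
      rw [natDegree_sub_C, natDegree_mul (X_sub_C_ne_zero _) h0, natDegree_X_sub_C] at h1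
      omega
  have e : (1 + X) * (f * gegenbauerPoly n m) =
      C (f.eval 1) * ((1 + X) * gegenbauerPoly n m) -
        (1 - X ^ 2) * (gegenbauerPoly n m * r) := by
    rw [C_1] at hr
    linear_combination (1 + X) * gegenbauerPoly n m * hr
  rw [e, map_sub, map_C_mul, h.map_one_add_X_mul_gegenbauerPoly hn,
    h.map_gegenbauerPoly_mul hn hr', mul_one, sub_zero]

/-- The sharp bound for the value at `1` of a polynomial in terms of its norm for the weight
`1 + X`. -/
theorem sq_eval_one_le (h : IsZonalFunctional n L) (hn : 2 ≤ n)
    {m : ℕ} (hL : ∀ f : ℝ[X], 0 ≤ L ((1 + X) * f ^ 2)) {f : ℝ[X]} (hf : f.natDegree ≤ m) :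
    f.eval 1 ^ 2 ≤ ((n + m - 1).choose m : ℝ) * L ((1 + X) * f ^ 2) := by
  set q := gegenbauerPoly n m
  have hq1 : q.eval 1 = ((n + m - 1).choose m : ℝ) := eval_one_gegenbauerPoly (by omega) m
  have hpos : 0 < q.eval 1 := by
    rw [hq1]; exact_mod_cast Nat.choose_pos (by omega)
  have hfq : L ((1 + X) * (f * q)) = f.eval 1 := h.map_one_add_X_mul_mul_gegenbauerPoly hn hf
  have hqq : L ((1 + X) * (q * q)) = q.eval 1 :=
    h.map_one_add_X_mul_mul_gegenbauerPoly hn (natDegree_gegenbauerPoly_le n m)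
  -- Cauchy-Schwarz in explicit form: q represents evaluation at 1, so its own squared norm is q(1).
  have h1 := hL (C (q.eval 1) * f - C (f.eval 1) * q)
  have e : (1 + X) * (C (q.eval 1) * f - C (f.eval 1) * q) ^ 2 =
      C (q.eval 1 ^ 2) * ((1 + X) * f ^ 2) - C (2 * q.eval 1 * f.eval 1) * ((1 + X) * (f * q)) +
        C (f.eval 1 ^ 2) * ((1 + X) * (q * q)) := by
    simp only [map_mul, map_pow, map_ofNat]; ring
  rw [e, map_add, map_sub, map_C_mul, map_C_mul, map_C_mul, hfq, hqq] at h1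
  rw [← hq1]
  have h2 : 0 ≤ q.eval 1 * (q.eval 1 * L ((1 + X) * f ^ 2) - f.eval 1 ^ 2) := by linarith
  linarith [nonneg_of_mul_nonneg_right h2 hpos]

end IsZonalFunctional

/-! ### The weight (1 - t²)ᵃ and the functional f₀ -/

section jacobiWeight

open MeasureTheory intervalIntegral

theorem intervalIntegrable_rpow_mul_one_sub_rpow {a : ℝ} (ha : -1 < a) :
    IntervalIntegrable (fun x : ℝ => x ^ a * (1 - x) ^ a) volume 0 1 := by
  have h := (Complex.betaIntegral_convergent (u := ((a + 1 : ℝ) : ℂ)) (v := ((a + 1 : ℝ) : ℂ))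
    (by rw [Complex.ofReal_re]; linarith) (by rw [Complex.ofReal_re]; linarith)).norm
  refine h.congr_uIoo fun x hx => ?_
  rw [Set.uIoo_of_le zero_le_one] at hx
  have h1 : (((a + 1 : ℝ) : ℂ) - 1) = ((a : ℝ) : ℂ) := by push_cast; ring
  have h2 : (1 - (x : ℂ)) = ((1 - x : ℝ) : ℂ) := by push_cast; ring
  simp only [h1, h2]
  rw [← Complex.ofReal_cpow hx.1.le, ← Complex.ofReal_cpow (by linarith [hx.2]),
    ← Complex.ofReal_mul, Complex.norm_real, Real.norm_of_nonneg]
  exact mul_nonneg (Real.rpow_nonneg hx.1.le _) (Real.rpow_nonneg (by linarith [hx.2]) _)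

theorem integral_rpow_mul_one_sub_rpow {a : ℝ} (ha : -1 < a) :
    ∫ x in (0 : ℝ)..1, x ^ a * (1 - x) ^ a = Real.Gamma (a + 1) ^ 2 / Real.Gamma (2 * a + 2) := by
  have h := ProbabilityTheory.beta_eq_betaIntegralReal (a + 1) (a + 1) (by linarith) (by linarith)
  have h1 : Complex.betaIntegral ((a + 1 : ℝ) : ℂ) ((a + 1 : ℝ) : ℂ) =
      ((∫ x in (0 : ℝ)..1, x ^ a * (1 - x) ^ a : ℝ) : ℂ) := by
    rw [Complex.betaIntegral, ← intervalIntegral.integral_ofReal]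
    refine integral_congr fun x hx => ?_
    rw [Set.uIcc_of_le zero_le_one] at hx
    have h1 : (((a + 1 : ℝ) : ℂ) - 1) = ((a : ℝ) : ℂ) := by push_cast; ring
    have h2 : (1 - (x : ℂ)) = ((1 - x : ℝ) : ℂ) := by push_cast; ring
    simp only [h1, h2]
    rw [← Complex.ofReal_cpow hx.1, ← Complex.ofReal_cpow (by linarith [hx.2]),
      ← Complex.ofReal_mul]
  rw [h1, Complex.ofReal_re] at h
  rw [← h, ProbabilityTheory.beta, sq]
  congr 2
  ring

/-- For x = (t + 1)/2 one has x(1 - x) = (1 - t²)/4, which transfers the Beta integral to [-1, 1].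
-/
theorem rpow_mul_one_sub_rpow_comp {a t : ℝ} (ht : t ∈ Set.Icc (-1 : ℝ) 1) :
    (1 / 2 * t + 1 / 2) ^ a * (1 - (1 / 2 * t + 1 / 2)) ^ a = (4 : ℝ)⁻¹ ^ a * (1 - t ^ 2) ^ a := by
  rw [← Real.mul_rpow (by linarith [ht.1]) (by linarith [ht.2]),
    ← Real.mul_rpow (by norm_num) (by nlinarith [ht.1, ht.2])]
  congr 1
  ring

theorem intervalIntegrable_one_sub_sq_rpow {a : ℝ} (ha : -1 < a) :
    IntervalIntegrable (fun t : ℝ => (1 - t ^ 2) ^ a) volume (-1) 1 := by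
  have h := (intervalIntegrable_rpow_mul_one_sub_rpow ha).comp_add_right (1 / 2)
  have h2 := h.comp_mul_left (c := 1 / 2)
  have h3 : IntervalIntegrable (fun t : ℝ => (1 / 2 * t + 1 / 2) ^ a * (1 - (1 / 2 * t + 1 / 2)) ^ a)
      volume (-1) 1 := by
    convert h2 using 1 <;> norm_num
  have h4 := h3.const_mul ((4 : ℝ) ^ a)
  refine h4.congr_uIoo fun t ht => ?_
  rw [Set.uIoo_of_le (by norm_num)] at ht
  simp only
  rw [rpow_mul_one_sub_rpow_comp ⟨ht.1.le, ht.2.le⟩, ← mul_assoc,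
    ← Real.mul_rpow (by norm_num) (by norm_num)]
  norm_num

theorem integral_one_sub_sq_rpow {a : ℝ} (ha : -1 < a) :
    ∫ t in (-1 : ℝ)..1, (1 - t ^ 2) ^ a =
      2 ^ (2 * a + 1) * (Real.Gamma (a + 1) ^ 2 / Real.Gamma (2 * a + 2)) := by
  have h1 := integral_comp_mul_add (a := -1) (b := 1) (fun x : ℝ => x ^ a * (1 - x) ^ a)
    (c := 1 / 2) (by norm_num) (1 / 2)
  rw [show (1 / 2 * (-1) + 1 / 2 : ℝ) = 0 by norm_num, show (1 / 2 * 1 + 1 / 2 : ℝ) = 1 by norm_num,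
    integral_rpow_mul_one_sub_rpow ha] at h1
  have h2 : ∫ t in (-1 : ℝ)..1, (1 / 2 * t + 1 / 2) ^ a * (1 - (1 / 2 * t + 1 / 2)) ^ a =
      (4 : ℝ)⁻¹ ^ a * ∫ t in (-1 : ℝ)..1, (1 - t ^ 2) ^ a := by
    rw [← intervalIntegral.integral_const_mul]
    refine integral_congr fun t ht => ?_
    rw [Set.uIcc_of_le (by norm_num)] at ht
    exact rpow_mul_one_sub_rpow_comp ht
  rw [h2] at h1
  have h3 : (2 : ℝ) ^ (2 * a + 1) = 4 ^ a * 2 := by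
    rw [Real.rpow_add (by norm_num), Real.rpow_mul (by norm_num)]; norm_num
  have h4 : (4 : ℝ) ^ a * (4 : ℝ)⁻¹ ^ a = 1 := by
    rw [← Real.mul_rpow (by norm_num) (by norm_num)]; norm_num
  rw [h3]
  simp only [smul_eq_mul, one_div, inv_inv] at h1
  rw [mul_assoc, ← h1, ← mul_assoc, h4, one_mul]

theorem intervalIntegrable_eval_mul_weight (p : ℝ[X]) {a : ℝ} (ha : -1 < a) :
    IntervalIntegrable (fun t : ℝ => p.eval t * (1 - t ^ 2) ^ a) volume (-1) 1 :=
  (intervalIntegrable_one_sub_sq_rpow ha).continuousOn_mul p.continuous.continuousOn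

theorem neg_one_lt_weight_exponent {n : ℕ} (hn : 2 ≤ n) : (-1 : ℝ) < ((n : ℝ) - 3) / 2 := by
  have : (2 : ℝ) ≤ n := by exact_mod_cast hn
  linarith

/-- `gegenbauerZero` as a linear functional. -/
noncomputable def gegenbauerFunctional (n : ℕ) (hn : 2 ≤ n) : ℝ[X] →ₗ[ℝ] ℝ where
  toFun := gegenbauerZero n
  map_add' p q := by
    have ha := neg_one_lt_weight_exponent hn
    simp only [gegenbauerZero, eval_add, add_mul]
    rw [integral_add (intervalIntegrable_eval_mul_weight p ha)
      (intervalIntegrable_eval_mul_weight q ha), mul_add]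
  map_smul' c p := by
    simp only [gegenbauerZero, eval_smul, smul_eq_mul, mul_assoc, RingHom.id_apply]
    rw [intervalIntegral.integral_const_mul]
    ring

theorem gegenbauerFunctional_apply {n : ℕ} (hn : 2 ≤ n) (f : ℝ[X]) :
    gegenbauerFunctional n hn f = gegenbauerZero n f := rfl

/-- The integrand is the derivative of p(t)(1 - t²)ᵇ, which vanishes at both ends because b > 0. -/
theorem integral_pearson (p : ℝ[X]) {b : ℝ} (hb : 0 < b) :
    ∫ t in (-1 : ℝ)..1, ((1 - X ^ 2) * derivative p - C (2 * b) * (X * p)).eval t *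
      (1 - t ^ 2) ^ (b - 1) = 0 := by
  have h := integral_eq_sub_of_hasDerivAt_of_le (a := (-1 : ℝ)) (b := 1) (by norm_num)
    (f := fun t => p.eval t * (1 - t ^ 2) ^ b)
    (f' := fun t => ((1 - X ^ 2) * derivative p - C (2 * b) * (X * p)).eval t *
      (1 - t ^ 2) ^ (b - 1)) ?_ ?_ (intervalIntegrable_eval_mul_weight _ (by linarith))
  · rw [h]; norm_num [Real.zero_rpow hb.ne']
  · exact (p.continuous.mul ((by fun_prop : Continuous fun t : ℝ => 1 - t ^ 2).rpow_const
      fun _ => Or.inr hb.le)).continuousOn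
  · intro t ht
    have hpos : 0 < 1 - t ^ 2 := by nlinarith [ht.1, ht.2]
    have h1 : HasDerivAt (fun t : ℝ => 1 - t ^ 2) (-(2 * t)) t := by
      simpa using (hasDerivAt_pow 2 t).const_sub 1
    have h2 := (p.hasDerivAt t).mul (h1.rpow_const (p := b) (Or.inl hpos.ne'))
    refine h2.congr_deriv ?_
    have h3 : (1 - t ^ 2) ^ b = (1 - t ^ 2) ^ (b - 1) * (1 - t ^ 2) := by
      rw [← Real.rpow_add_one hpos.ne']; ring_nf
    simp only [h3, eval_sub, eval_mul, eval_one, eval_pow, eval_X, eval_C]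
    ring

theorem isZonalFunctional_gegenbauerFunctional {n : ℕ} (hn : 2 ≤ n) :
    IsZonalFunctional n (gegenbauerFunctional n hn) where
  map_one := by
    have hn' : (2 : ℝ) ≤ n := by exact_mod_cast hn
    have h := integral_one_sub_sq_rpow (neg_one_lt_weight_exponent hn)
    rw [gegenbauerFunctional_apply, gegenbauerZero]
    simp only [eval_one, one_mul]
    rw [h, show 2 * (((n : ℝ) - 3) / 2) + 1 = n - 2 by ring,
      show 2 * (((n : ℝ) - 3) / 2) + 2 = n - 1 by ring,
      show ((n : ℝ) - 3) / 2 + 1 = (n - 1) / 2 by ring]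
    have h1 : Real.Gamma ((n : ℝ) - 1) ≠ 0 := (Real.Gamma_pos_of_pos (by linarith)).ne'
    have h2 : Real.Gamma (((n : ℝ) - 1) / 2) ≠ 0 := (Real.Gamma_pos_of_pos (by linarith)).ne'
    have h3 : (2 : ℝ) ^ ((n : ℝ) - 2) ≠ 0 := (Real.rpow_pos_of_pos (by norm_num) _).ne'
    field_simp
  pearson p := by
    have hn' : (2 : ℝ) ≤ n := by exact_mod_cast hn
    have h := integral_pearson p (b := ((n : ℝ) - 1) / 2) (by linarith)
    have h1 : gegenbauerFunctional n hn
        ((1 - X ^ 2) * derivative p - C ((n : ℝ) - 1) * (X * p)) = 0 := by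
      rw [gegenbauerFunctional_apply, gegenbauerZero]
      rw [show ((n : ℝ) - 1) / 2 - 1 = (n - 3) / 2 by ring,
        show 2 * (((n : ℝ) - 1) / 2) = n - 1 by ring] at h
      rw [h, mul_zero]
    rw [LinearMap.map_sub, IsZonalFunctional.map_C_mul] at h1
    linarith

theorem gegenbauerFunctional_pos {n : ℕ} (hn : 2 ≤ n) {f : ℝ[X]} (hf : f ≠ 0)
    (hpos : ∀ t ∈ Set.Ioo (-1 : ℝ) 1, 0 ≤ f.eval t) : 0 < gegenbauerFunctional n hn f := by
  have hn' : (2 : ℝ) ≤ n := by exact_mod_cast hn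
  rw [gegenbauerFunctional_apply, gegenbauerZero]
  have h1 : 0 < Real.Gamma ((n : ℝ) - 1) := Real.Gamma_pos_of_pos (by linarith)
  have h2 : 0 < Real.Gamma (((n : ℝ) - 1) / 2) := Real.Gamma_pos_of_pos (by linarith)
  refine mul_pos (div_pos h1 (by positivity)) ?_
  have hw : ∀ t ∈ Set.Ioo (-1 : ℝ) 1, 0 < (1 - t ^ 2) ^ (((n : ℝ) - 3) / 2) := fun t ht =>
    Real.rpow_pos_of_pos (by nlinarith [ht.1, ht.2]) _
  rw [integral_pos_iff_support_of_nonneg_ae' ?_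
    (intervalIntegrable_eval_mul_weight f (neg_one_lt_weight_exponent hn))]
  · refine ⟨by norm_num, ?_⟩
    have hsub : Set.Ioo (-1 : ℝ) 1 \ (f.roots.toFinset : Set ℝ) ⊆
        Function.support (fun t : ℝ => f.eval t * (1 - t ^ 2) ^ (((n : ℝ) - 3) / 2)) ∩
          Set.Ioc (-1) 1 := by
      rintro t ⟨ht, ht'⟩
      refine ⟨mul_ne_zero (fun h0 => ht' ?_) (hw t ht).ne', ht.1, ht.2.le⟩
      simpa [hf] using h0
    refine lt_of_lt_of_le ?_ (measure_mono hsub)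
    rw [measure_sdiff_null (Finset.measure_zero _ _), Real.volume_Ioo]
    norm_num
  · rw [Set.uIoc_of_le (by norm_num), ← Measure.restrict_congr_set Ioo_ae_eq_Ioc]
    refine (ae_restrict_mem measurableSet_Ioo).mono fun t ht => ?_
    exact mul_nonneg (hpos t ht) (hw t ht).le

end jacobiWeight

/-! ### Positivity after removing the mass at 1 -/

/-- The functional `f ↦ f₀ - f(1) / N`. -/
noncomputable def deletedFunctional (n N : ℕ) (hn : 2 ≤ n) : ℝ[X] →ₗ[ℝ] ℝ :=
  gegenbauerFunctional n hn - (N : ℝ)⁻¹ • leval 1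

theorem deletedFunctional_apply {n N : ℕ} (hn : 2 ≤ n) (f : ℝ[X]) :
    deletedFunctional n N hn f = gegenbauerZero n f - f.eval 1 / N := by
  simp [deletedFunctional, gegenbauerFunctional_apply, leval, div_eq_inv_mul]

theorem posOnSquares_deletedFunctional_one_sub {n N : ℕ} (hn : 2 ≤ n) (k : ℕ) :
    PosOnSquares (deletedFunctional n N hn) (1 - X) k := by
  intro f hf _
  rw [deletedFunctional_apply, ← gegenbauerFunctional_apply hn]
  simp only [eval_mul, eval_sub, eval_one, eval_X, sub_self, zero_mul, zero_div, sub_zero]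
  refine gegenbauerFunctional_pos hn (mul_ne_zero ?_ (pow_ne_zero 2 hf)) fun t ht => ?_
  · rw [← neg_ne_zero, neg_sub, ← C_1]; exact X_sub_C_ne_zero _
  · simp only [eval_mul, eval_sub, eval_one, eval_X, eval_pow]
    exact mul_nonneg (by linarith [ht.2]) (sq_nonneg _)

/-- The removed mass costs 2f(1)²/N. The sharp bound for degree k - 1 makes this smaller than the
integral exactly under the hypothesis on N. -/
theorem posOnSquares_deletedFunctional_one_add {n N k : ℕ} (hn : 2 ≤ n) (hk : 1 ≤ k)
    (hN : 2 * (n + k - 2).choose (n - 1) < N) :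
    PosOnSquares (deletedFunctional n N hn) (1 + X) k := by
  intro f hf hfk
  have hX : (1 + X : ℝ[X]) ≠ 0 := by rw [add_comm, ← C_1]; exact X_add_C_ne_zero _
  have hev : ∀ (g : ℝ[X]), ∀ t ∈ Set.Ioo (-1 : ℝ) 1, 0 ≤ ((1 + X) * g ^ 2).eval t := by
    intro g t ht
    simp only [eval_mul, eval_add, eval_one, eval_X, eval_pow]
    exact mul_nonneg (by linarith [ht.1]) (sq_nonneg _)
  have hpos := gegenbauerFunctional_pos hn (mul_ne_zero hX (pow_ne_zero 2 hf)) (hev f)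
  have hle := (isZonalFunctional_gegenbauerFunctional hn).sq_eval_one_le hn (m := k - 1)
    (fun g => by
      by_cases hg : g = 0
      · simp [hg]
      · exact (gegenbauerFunctional_pos hn (mul_ne_zero hX (pow_ne_zero 2 hg)) (hev g)).le)
    (f := f) (by omega)
  rw [deletedFunctional_apply, ← gegenbauerFunctional_apply hn]
  set I := gegenbauerFunctional n hn ((1 + X) * f ^ 2)
  have hc : (n + (k - 1) - 1).choose (k - 1) = (n + k - 2).choose (n - 1) := by
    rw [show n + (k - 1) - 1 = n + k - 2 by omega]
    exact Nat.choose_symm_of_eq_add (by omega)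
  rw [hc] at hle
  have hN' : 2 * ((n + k - 2).choose (n - 1) : ℝ) < N := by exact_mod_cast hN
  have hN0 : (0 : ℝ) < N := by
    have : (0 : ℝ) ≤ ((n + k - 2).choose (n - 1) : ℝ) := Nat.cast_nonneg _
    linarith
  have e : ((1 + X) * f ^ 2).eval 1 = 2 * f.eval 1 ^ 2 := by
    simp only [eval_mul, eval_add, eval_one, eval_X, eval_pow]; ring
  rw [e, sub_pos, div_lt_iff₀ hN0]
  nlinarith

theorem isDesignQuadrature_iff {n N k : ℕ} (hn : 2 ≤ n) (α ρ : Fin k → ℝ) :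
    IsDesignQuadrature n N k α ρ ↔ IsGaussQuadrature (deletedFunctional n N hn) k α ρ := by
  constructor
  · rintro ⟨h1, h2, h3, h4, h5⟩
    exact ⟨h1, h2, h3, h4, fun f hf => by rw [deletedFunctional_apply, h5 f hf]; ring⟩
  · rintro ⟨h1, h2, h3, h4, h5⟩
    refine ⟨h1, h2, h3, h4, fun f hf => ?_⟩
    have := h5 f hf
    rw [deletedFunctional_apply] at this
    linarith

/-! ### Zonal means over the sphere through Gaussian integrals -/

section sphereMoments

open MeasureTheory Set Real

/-- The radial integral in the polar decomposition of Gaussian moments. -/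
noncomputable def radialGaussian (s : ℕ) : ℝ := ∫ r in Ioi (0 : ℝ), r ^ s * exp (-r ^ 2)

theorem radialGaussian_eq (s : ℕ) : radialGaussian s = 1 / 2 * Real.Gamma (((s : ℝ) + 1) / 2) := by
  have h := integral_rpow_mul_exp_neg_rpow (p := 2) (q := s) (by norm_num)
    (by have := Nat.cast_nonneg (α := ℝ) s; linarith)
  rw [← h, radialGaussian]
  refine setIntegral_congr_fun measurableSet_Ioi fun r _ => ?_
  simp

theorem radialGaussian_pos (s : ℕ) : 0 < radialGaussian s := by
  rw [radialGaussian_eq]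
  exact mul_pos (by norm_num) (Real.Gamma_pos_of_pos (by positivity))

theorem radialGaussian_add_two (s : ℕ) :
    2 * radialGaussian (s + 2) = (s + 1) * radialGaussian s := by
  rw [radialGaussian_eq, radialGaussian_eq]
  have h := Real.Gamma_add_one (s := ((s : ℝ) + 1) / 2) (by positivity)
  have e : (((s + 2 : ℕ) : ℝ) + 1) / 2 = ((s : ℝ) + 1) / 2 + 1 := by push_cast; ring
  rw [e, h]
  ring

variable {n : ℕ}

theorem integrable_inner_pow_mul_gaussian [NeZero n] (x : UnitSphere n) (j : ℕ) :
    Integrable fun y : EuclideanSpace ℝ (Fin n) => inner ℝ (x : EuclideanSpace ℝ (Fin n)) y ^ j *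
      exp (-‖y‖ ^ 2) := by
  have h : Integrable (fun y : EuclideanSpace ℝ (Fin n) => ‖y‖ ^ j * exp (-‖y‖ ^ 2)) := by
    refine (integrable_fun_norm_addHaar (volume : Measure (EuclideanSpace ℝ (Fin n)))
      (f := fun r : ℝ => r ^ j * exp (-r ^ 2))).2 ?_
    have h1 := integrableOn_rpow_mul_exp_neg_mul_sq (b := 1) one_pos
      (s := ((n - 1 + j : ℕ) : ℝ)) (by
        have := Nat.cast_nonneg (α := ℝ) (n - 1 + j); linarith)
    refine h1.congr_fun (fun r _ => ?_) measurableSet_Ioi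
    simp only [rpow_natCast, finrank_euclideanSpace, Fintype.card_fin, smul_eq_mul, pow_add]
    ring_nf
  refine h.mono' (by fun_prop) (ae_of_all _ fun y => ?_)
  rw [norm_mul, norm_pow, Real.norm_of_nonneg (exp_pos _).le]
  gcongr
  have h2 := norm_inner_le_norm (𝕜 := ℝ) (x : EuclideanSpace ℝ (Fin n)) y
  rwa [norm_eq_of_mem_sphere, one_mul] at h2

/-- The integral over ℝⁿ of the derivative of ⟨x, y⟩ᵐ exp(-‖y‖²) in the direction x is zero; as ‖x‖
= 1, that derivative is the difference of the two integrands. -/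
theorem integral_inner_pow_gaussian_recurrence [NeZero n] (x : UnitSphere n) (m : ℕ) :
    m * ∫ y : EuclideanSpace ℝ (Fin n), inner ℝ (x : EuclideanSpace ℝ (Fin n)) y ^ (m - 1) *
      exp (-‖y‖ ^ 2) =
    2 * ∫ y : EuclideanSpace ℝ (Fin n), inner ℝ (x : EuclideanSpace ℝ (Fin n)) y ^ (m + 1) *
      exp (-‖y‖ ^ 2) := by
  have hi := fun j => integrable_inner_pow_mul_gaussian x j
  have hx : inner ℝ (x : EuclideanSpace ℝ (Fin n)) (x : EuclideanSpace ℝ (Fin n)) = 1 := by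
    rw [real_inner_self_eq_norm_sq, norm_eq_of_mem_sphere, one_pow]
  set g' : EuclideanSpace ℝ (Fin n) → ℝ := fun y =>
    m * (inner ℝ (x : EuclideanSpace ℝ (Fin n)) y ^ (m - 1) * exp (-‖y‖ ^ 2)) -
      2 * (inner ℝ (x : EuclideanSpace ℝ (Fin n)) y ^ (m + 1) * exp (-‖y‖ ^ 2)) with hg'
  have hg'i : Integrable g' := ((hi (m - 1)).const_mul _).sub ((hi (m + 1)).const_mul _)
  have hder : ∀ y, HasLineDerivAt ℝ (fun y : EuclideanSpace ℝ (Fin n) =>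
      inner ℝ (x : EuclideanSpace ℝ (Fin n)) y ^ m * exp (-‖y‖ ^ 2)) (g' y) y
      (x : EuclideanSpace ℝ (Fin n)) := by
    intro y
    have h1 : HasDerivAt (fun t : ℝ => inner ℝ (x : EuclideanSpace ℝ (Fin n)) y + t) 1 0 := by
      simpa using (hasDerivAt_id (0 : ℝ)).const_add
        (inner ℝ (x : EuclideanSpace ℝ (Fin n)) y)
    have h2 : HasDerivAt (fun t : ℝ => -(‖y‖ ^ 2 +
        2 * t * inner ℝ (x : EuclideanSpace ℝ (Fin n)) y + t ^ 2))
        (-(2 * inner ℝ (x : EuclideanSpace ℝ (Fin n)) y)) 0 := by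
      have h3 := ((((hasDerivAt_id (0 : ℝ)).const_mul 2).mul_const
        (inner ℝ (x : EuclideanSpace ℝ (Fin n)) y)).const_add (‖y‖ ^ 2)).add
          (hasDerivAt_pow 2 (0 : ℝ))
      refine h3.neg.congr_deriv ?_
      simp
    have h4 := (h1.pow m).mul h2.exp
    unfold HasLineDerivAt
    have e : (fun t : ℝ => inner ℝ (x : EuclideanSpace ℝ (Fin n))
        (y + t • (x : EuclideanSpace ℝ (Fin n))) ^ m *
          exp (-‖y + t • (x : EuclideanSpace ℝ (Fin n))‖ ^ 2)) =
        (fun t : ℝ => (inner ℝ (x : EuclideanSpace ℝ (Fin n)) y + t) ^ m *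
          exp (-(‖y‖ ^ 2 + 2 * t * inner ℝ (x : EuclideanSpace ℝ (Fin n)) y + t ^ 2))) := by
      funext t
      rw [inner_add_right, inner_smul_right, hx, mul_one, norm_add_sq_real, inner_smul_right,
        norm_smul, norm_eq_of_mem_sphere, mul_one, Real.norm_eq_abs, sq_abs,
        real_inner_comm (x : EuclideanSpace ℝ (Fin n)) y]
      ring_nf
    rw [e]
    refine h4.congr_deriv ?_
    simp only [hg', add_zero, mul_zero, zero_mul, ne_eq, OfNat.ofNat_ne_zero, not_false_eq_true,
      zero_pow, mul_one, Pi.pow_apply]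
    ring
  have h := integral_bilinear_hasLineDerivAt_right_eq_neg_left_of_integrable
    (μ := (volume : Measure (EuclideanSpace ℝ (Fin n))))
    (f := fun _ => (1 : ℝ)) (f' := fun _ => 0) (v := (x : EuclideanSpace ℝ (Fin n)))
    (g := fun y => inner ℝ (x : EuclideanSpace ℝ (Fin n)) y ^ m * exp (-‖y‖ ^ 2)) (g' := g')
    (B := ContinuousLinearMap.mul ℝ ℝ) (by simp) (by simpa using hg'i) (by simpa using hi m)
    (fun y _ => hasDerivAt_const _ _) (fun y _ => hder y)
  simp only [ContinuousLinearMap.mul_apply', one_mul, zero_mul, integral_zero, neg_zero] at h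
  rw [hg', integral_sub ((hi (m - 1)).const_mul _) ((hi (m + 1)).const_mul _),
    integral_const_mul, integral_const_mul] at h
  linarith

/-- Polar coordinates: the integrand is homogeneous of degree j apart from the Gaussian, and the
radial measure has density rⁿ⁻¹. -/
theorem integral_inner_pow_gaussian_eq [NeZero n] (x : UnitSphere n) (j : ℕ) :
    ∫ y : EuclideanSpace ℝ (Fin n), inner ℝ (x : EuclideanSpace ℝ (Fin n)) y ^ j *
      exp (-‖y‖ ^ 2) =
    (∫ y, sphereInner x y ^ j ∂(surfaceMeasure n)) * radialGaussian (n - 1 + j) := by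
  set F : EuclideanSpace ℝ (Fin n) → ℝ := fun y =>
    inner ℝ (x : EuclideanSpace ℝ (Fin n)) y ^ j * exp (-‖y‖ ^ 2) with hF
  set μ : Measure (EuclideanSpace ℝ (Fin n)) := volume
  have hrad : ∫ r : Ioi (0 : ℝ), (r : ℝ) ^ j * exp (-(r : ℝ) ^ 2) ∂(Measure.volumeIoiPow (n - 1)) =
      radialGaussian (n - 1 + j) := by
    simp only [Measure.volumeIoiPow, ENNReal.ofReal]
    rw [integral_withDensity_eq_integral_smul (measurable_subtype_coe.pow_const _).real_toNNReal,
      integral_subtype_comap measurableSet_Ioi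
        fun r : ℝ => Real.toNNReal (r ^ (n - 1)) • (r ^ j * exp (-r ^ 2)), radialGaussian]
    refine setIntegral_congr_fun measurableSet_Ioi fun r hr => ?_
    rw [NNReal.smul_def, Real.coe_toNNReal _ (pow_nonneg (le_of_lt hr) _), smul_eq_mul, pow_add,
      mul_assoc]
  calc ∫ y, F y = ∫ y : ({(0)}ᶜ : Set (EuclideanSpace ℝ (Fin n))), F y ∂(μ.comap (↑)) := by
        rw [integral_subtype_comap (measurableSet_singleton _).compl F,
          restrict_compl_singleton]
    _ = ∫ p, sphereInner x p.1 ^ j * ((p.2 : ℝ) ^ j * exp (-(p.2 : ℝ) ^ 2))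
          ∂(μ.toSphere.prod (Measure.volumeIoiPow (n - 1))) := by
        have h := μ.measurePreserving_homeomorphUnitSphereProd.integral_comp
          (Homeomorph.measurableEmbedding _)
          (fun p => sphereInner x p.1 ^ j * ((p.2 : ℝ) ^ j * exp (-(p.2 : ℝ) ^ 2)))
        rw [finrank_euclideanSpace, Fintype.card_fin] at h
        rw [← h]
        refine integral_congr_ae (ae_of_all _ fun y => ?_)
        have hy : ‖(y : EuclideanSpace ℝ (Fin n))‖ ≠ 0 := norm_ne_zero_iff.2 y.2
        simp only [hF, sphereInner, homeomorphUnitSphereProd_apply_fst_coe,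
          homeomorphUnitSphereProd_apply_snd_coe, inner_smul_right, mul_pow]
        have h1 : ‖(y : EuclideanSpace ℝ (Fin n))‖⁻¹ ^ j * ‖(y : EuclideanSpace ℝ (Fin n))‖ ^ j = 1 := by
          rw [← mul_pow, inv_mul_cancel₀ hy, one_pow]
        linear_combination (-inner ℝ (x : EuclideanSpace ℝ (Fin n)) (y : EuclideanSpace ℝ (Fin n)) ^ j *
          exp (-‖(y : EuclideanSpace ℝ (Fin n))‖ ^ 2)) * h1
    _ = _ := by
        rw [integral_prod_mul (fun y => sphereInner x y ^ j)
          (fun r : Ioi (0 : ℝ) => (r : ℝ) ^ j * exp (-(r : ℝ) ^ 2)), hrad]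
        rfl

instance isFiniteMeasure_surfaceMeasure (n : ℕ) : IsFiniteMeasure (surfaceMeasure n) := by
  unfold surfaceMeasure; infer_instance

theorem integrable_surfaceMeasure_of_continuous {f : UnitSphere n → ℝ} (hf : Continuous f) :
    Integrable f (surfaceMeasure n) :=
  hf.integrable_of_hasCompactSupport (HasCompactSupport.of_compactSpace f)

theorem continuous_sphereInner (x : UnitSphere n) : Continuous fun y => sphereInner x y := by
  unfold sphereInner; fun_prop

theorem integrable_eval_sphereInner (x : UnitSphere n) (f : ℝ[X]) :
    Integrable (fun y => f.eval (sphereInner x y)) (surfaceMeasure n) :=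
  integrable_surfaceMeasure_of_continuous (f.continuous.comp (continuous_sphereInner x))

theorem surfaceMeasure_real_univ_pos [NeZero n] : 0 < (surfaceMeasure n).real univ := by
  refine ENNReal.toReal_pos ?_ (measure_ne_top _ _)
  rw [Ne, Measure.measure_univ_eq_zero]
  exact Measure.toSphere_ne_zero _

/-- The average over the sphere of the zonal function with pole `x` attached to a polynomial. -/
noncomputable def zonalMean (x : UnitSphere n) : ℝ[X] →ₗ[ℝ] ℝ where
  toFun f := ((surfaceMeasure n).real univ)⁻¹ * ∫ y, f.eval (sphereInner x y) ∂(surfaceMeasure n)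
  map_add' f g := by
    simp only [eval_add]
    rw [integral_add (integrable_eval_sphereInner x f) (integrable_eval_sphereInner x g), mul_add]
  map_smul' c f := by
    simp only [eval_smul, smul_eq_mul, RingHom.id_apply]
    rw [integral_const_mul]
    ring

theorem zonalMean_apply (x : UnitSphere n) (f : ℝ[X]) : zonalMean x f =
    ((surfaceMeasure n).real univ)⁻¹ * ∫ y, f.eval (sphereInner x y) ∂(surfaceMeasure n) := rfl

theorem zonalMean_recurrence [NeZero n] (x : UnitSphere n) (m : ℕ) :
    m * zonalMean x (X ^ (m - 1)) = (n + m - 1 : ℝ) * zonalMean x (X ^ (m + 1)) := by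
  have h := integral_inner_pow_gaussian_recurrence x m
  rw [integral_inner_pow_gaussian_eq, integral_inner_pow_gaussian_eq] at h
  simp only [zonalMean_apply, eval_pow, eval_X]
  have hn : 1 ≤ n := NeZero.one_le
  rcases m with _ | m
  -- For m = 0 the truncated exponent m - 1 carries the factor 0; the claim reduces to the vanishing
  -- of the first moment.
  · simp only [Nat.cast_zero, zero_mul, zero_add, pow_one] at h ⊢
    have h1 := (mul_eq_zero.1 h.symm).resolve_left (by norm_num)
    rw [(mul_eq_zero.1 h1).resolve_right (radialGaussian_pos _).ne']
    simp
  · have e : n - 1 + (m + 1 + 1) = n - 1 + m + 2 := by omega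
    rw [Nat.add_sub_cancel, e] at h
    rw [Nat.add_sub_cancel]
    have h1 := radialGaussian_add_two (n - 1 + m)
    have h2 := radialGaussian_pos (n - 1 + m)
    push_cast [Nat.cast_sub hn] at h h1 ⊢
    apply mul_left_cancel₀ h2.ne'
    linear_combination ((surfaceMeasure n).real univ)⁻¹ * h +
      ((surfaceMeasure n).real univ)⁻¹ * (∫ y, sphereInner x y ^ (m + 1 + 1) ∂surfaceMeasure n) * h1

theorem isZonalFunctional_zonalMean [NeZero n] (x : UnitSphere n) :
    IsZonalFunctional n (zonalMean x) where
  map_one := by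
    simp [zonalMean_apply, surfaceMeasure_real_univ_pos.ne']
  pearson p := by
    induction p using Polynomial.induction_on' with
    | add p q hp hq =>
      rw [derivative_add, mul_add, LinearMap.map_add, hp, hq, mul_add X, LinearMap.map_add,
        mul_add]
    | monomial m a =>
      rw [← C_mul_X_pow_eq_monomial]
      have h := zonalMean_recurrence x m
      rcases m with _ | m
      · simp only [Nat.cast_zero, zero_mul, zero_add, pow_one, add_zero] at h
        have e : (X : ℝ[X]) * (C a * X ^ 0) = C a * X := by ring
        rw [e, IsZonalFunctional.map_C_mul]
        simp only [pow_zero, mul_one, derivative_C, mul_zero, LinearMap.map_zero]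
        linear_combination a * h
      · rw [derivative_C_mul, derivative_X_pow]
        rw [Nat.add_sub_cancel] at h ⊢
        have e1 : (1 - X ^ 2 : ℝ[X]) * (C a * (C ((m + 1 : ℕ) : ℝ) * X ^ m)) =
            C (a * ((m + 1 : ℕ) : ℝ)) * (X ^ m - X ^ (m + 1 + 1)) := by
          rw [C_mul]; ring
        have e2 : (X : ℝ[X]) * (C a * X ^ (m + 1)) = C a * X ^ (m + 1 + 1) := by ring
        rw [e1, e2, IsZonalFunctional.map_C_mul, IsZonalFunctional.map_C_mul, LinearMap.map_sub]
        push_cast at h ⊢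
        linear_combination a * h

/-- The Funk-Hecke formula for the constant harmonic. -/
theorem zonalMean_eq_gegenbauerZero (hn : 2 ≤ n) (x : UnitSphere n) (f : ℝ[X]) :
    zonalMean x f = gegenbauerZero n f := by
  have : NeZero n := ⟨by omega⟩
  rw [(isZonalFunctional_zonalMean x).unique hn (isZonalFunctional_gegenbauerFunctional hn),
    gegenbauerFunctional_apply]

end sphereMoments

/-! ### Polynomial energies of designs -/

section designs

variable {n : ℕ}

/-- The linear form `⟨x, ·⟩` as a polynomial in `n` variables. -/
noncomputable def innerMvPolynomial (x : UnitSphere n) : MvPolynomial (Fin n) ℝ :=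
  ∑ i, MvPolynomial.C ((x : EuclideanSpace ℝ (Fin n)) i) * MvPolynomial.X i

theorem eval_innerMvPolynomial (x y : UnitSphere n) :
    MvPolynomial.eval (fun i => (y : EuclideanSpace ℝ (Fin n)) i) (innerMvPolynomial x) =
      sphereInner x y := by
  simp [innerMvPolynomial, sphereInner, PiLp.inner_apply, mul_comm]

theorem totalDegree_innerMvPolynomial_le (x : UnitSphere n) :
    (innerMvPolynomial x).totalDegree ≤ 1 := by
  refine (MvPolynomial.totalDegree_finsetSum _ _).trans (Finset.sup_le fun i _ => ?_)
  refine (MvPolynomial.totalDegree_mul _ _).trans ?_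
  simp [MvPolynomial.totalDegree_C, MvPolynomial.totalDegree_X]

theorem totalDegree_aeval_innerMvPolynomial_le (x : UnitSphere n) (f : ℝ[X]) :
    (aeval (innerMvPolynomial x) f).totalDegree ≤ f.natDegree := by
  rw [aeval_eq_sum_range]
  refine (MvPolynomial.totalDegree_finsetSum _ _).trans (Finset.sup_le fun i hi => ?_)
  refine (MvPolynomial.totalDegree_smul_le _ _).trans ?_
  refine (MvPolynomial.totalDegree_pow _ _).trans ?_
  have h1 := totalDegree_innerMvPolynomial_le x
  have h2 := Finset.mem_range.1 hi
  nlinarith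

theorem eval_aeval_innerMvPolynomial (x y : UnitSphere n) (f : ℝ[X]) :
    MvPolynomial.eval (fun i => (y : EuclideanSpace ℝ (Fin n)) i) (aeval (innerMvPolynomial x) f) =
      f.eval (sphereInner x y) := by
  have h : (MvPolynomial.eval fun i => (y : EuclideanSpace ℝ (Fin n)) i).comp
      (algebraMap ℝ (MvPolynomial (Fin n) ℝ)) = RingHom.id ℝ :=
    RingHom.ext fun a => by simp [MvPolynomial.algebraMap_eq]
  rw [aeval_def, hom_eval₂, eval_innerMvPolynomial, h, eval₂_id]

/-- A spherical design averages zonal polynomials correctly. -/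
theorem IsSphericalDesign.sum_eval_sphereInner (hn : 2 ≤ n) {τ : ℕ} {C : Finset (UnitSphere n)}
    (hC : IsSphericalDesign τ C) (x : UnitSphere n) {f : ℝ[X]} (hf : f.natDegree ≤ τ) :
    ∑ y ∈ C, f.eval (sphereInner x y) = C.card * gegenbauerZero n f := by
  have h := hC.2 _ ((totalDegree_aeval_innerMvPolynomial_le x f).trans hf)
  simp only [eval_aeval_innerMvPolynomial] at h
  have h0 : (C.card : ℝ) ≠ 0 := by exact_mod_cast hC.1.card_pos.ne'
  rw [← zonalMean_eq_gegenbauerZero hn x f, zonalMean_apply, h, mul_inv_cancel_left₀ h0]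

theorem sphereInner_self (x : UnitSphere n) : sphereInner x x = 1 := by
  rw [sphereInner, real_inner_self_eq_norm_sq, norm_eq_of_mem_sphere, one_pow]

theorem sphereInner_mem_Ico {x y : UnitSphere n} (h : x ≠ y) :
    sphereInner x y ∈ Set.Ico (-1 : ℝ) 1 := by
  have hx : ‖(x : EuclideanSpace ℝ (Fin n))‖ = 1 := norm_eq_of_mem_sphere x
  have hy : ‖(y : EuclideanSpace ℝ (Fin n))‖ = 1 := norm_eq_of_mem_sphere y
  refine ⟨?_, (inner_lt_one_iff_real_of_norm_eq_one hx hy).2 fun he => h (Subtype.ext he)⟩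
  have := neg_le_of_abs_le (abs_real_inner_le_norm (x : EuclideanSpace ℝ (Fin n)) y)
  rwa [hx, hy, mul_one] at this

theorem IsSphericalDesign.sum_offDiag_eval (hn : 2 ≤ n) {τ : ℕ} {C : Finset (UnitSphere n)}
    [DecidableEq (UnitSphere n)]
    (hC : IsSphericalDesign τ C) {f : ℝ[X]} (hf : f.natDegree ≤ τ) :
    ∑ p ∈ C.offDiag, f.eval (sphereInner p.1 p.2) =
      C.card * (gegenbauerZero n f * C.card - f.eval 1) := by
  have h1 : ∑ p ∈ C ×ˢ C, f.eval (sphereInner p.1 p.2) =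
      C.card * (C.card * gegenbauerZero n f) := by
    rw [Finset.sum_product]
    simp only [hC.sum_eval_sphereInner hn _ hf, Finset.sum_const, nsmul_eq_mul]
  have h2 : ∑ p ∈ C.diag, f.eval (sphereInner p.1 p.2) = C.card * f.eval 1 := by
    rw [Finset.sum_diag]
    simp only [sphereInner_self, Finset.sum_const, nsmul_eq_mul]
  rw [← Finset.diag_union_offDiag, Finset.sum_union (Finset.disjoint_diag_offDiag C), h2] at h1
  linarith

end designs

/-! ### Rolle's theorem with many zeros -/

section rolle

open Set

/-- Rolle's theorem for several zeros: the derivative vanishes at points that separate them. -/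
theorem exists_finset_deriv_eq_zero {g : ℝ → ℝ} {a b : ℝ} (hg : ContinuousOn g (Ico a b))
    {Z : Finset ℝ} {m : ℕ} (hZ : ∀ z ∈ Z, z ∈ Ico a b) (hcard : Z.card = m + 1)
    (hzero : ∀ z ∈ Z, g z = 0) :
    ∃ Z' : Finset ℝ, Z'.card = m ∧ Disjoint Z' Z ∧ ∀ z ∈ Z', z ∈ Ioo a b ∧ deriv g z = 0 := by
  let z : Fin (m + 1) → ℝ := Z.orderEmbOfFin hcard
  have hz : StrictMono z := (Z.orderEmbOfFin hcard).strictMono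
  have hmem : ∀ i, z i ∈ Z := Z.orderEmbOfFin_mem hcard
  have hR : ∀ i : Fin m, ∃ c ∈ Ioo (z i.castSucc) (z i.succ), deriv g c = 0 := fun i => by
    refine exists_deriv_eq_zero (hz i.castSucc_lt_succ) (hg.mono fun t ht => ?_) ?_
    · exact ⟨(hZ _ (hmem _)).1.trans ht.1, ht.2.trans_lt (hZ _ (hmem _)).2⟩
    · rw [hzero _ (hmem _), hzero _ (hmem _)]
  choose c hc hc0 using hR
  have hcm : StrictMono c := fun i j hij => by
    refine (hc i).2.trans_le (le_trans (hz.monotone ?_) (hc j).1.le)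
    exact Fin.succ_le_castSucc_iff.2 hij
  refine ⟨Finset.univ.map ⟨c, hcm.injective⟩, by simp, ?_, ?_⟩
  · rw [Finset.disjoint_left]
    intro x hx hxZ
    obtain ⟨i, -, rfl⟩ := Finset.mem_map.1 hx
    obtain ⟨j, hj⟩ : c i ∈ Set.range z := by
      rw [Finset.range_orderEmbOfFin]; exact hxZ
    have h1 := (hc i).1
    have h2 := (hc i).2
    rw [← hj, hz.lt_iff_lt, Fin.lt_def] at h1 h2
    simp at h1 h2
    omega
  · intro x hx
    obtain ⟨i, -, rfl⟩ := Finset.mem_map.1 hx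
    exact ⟨⟨(hZ _ (hmem _)).1.trans_lt (hc i).1, (hc i).2.trans (hZ _ (hmem _)).2⟩, hc0 i⟩

theorem exists_iteratedDeriv_eq_zero {a b : ℝ} (m : ℕ) : ∀ {g : ℝ → ℝ} {Z : Finset ℝ},
    ContDiffOn ℝ ((⊤ : ℕ∞) : WithTop ℕ∞) g (Ioo a b) → (∀ z ∈ Z, z ∈ Ioo a b) →
    Z.card = m + 1 → (∀ z ∈ Z, g z = 0) → ∃ ξ ∈ Ioo a b, iteratedDeriv m g ξ = 0 := by
  induction m with
  | zero =>
    intro g Z _ hZ hcard hzero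
    obtain ⟨z, hz⟩ := Finset.card_pos.1 (by omega : 0 < Z.card)
    exact ⟨z, hZ z hz, by simpa using hzero z hz⟩
  | succ m ih =>
    intro g Z hg hZ hcard hzero
    obtain ⟨z0, hz0⟩ := Finset.card_pos.1 (by omega : 0 < Z.card)
    -- Starting at the least zero gives a half-open interval inside (a, b), as the single Rolle step
    -- requires.
    set a' := Z.min' ⟨z0, hz0⟩
    have ha' : a' ∈ Ioo a b := hZ _ (Z.min'_mem _)
    obtain ⟨Z', h1, -, h2⟩ := exists_finset_deriv_eq_zero (a := a') (b := b)
      (hg.continuousOn.mono fun t ht => ⟨ha'.1.trans_le ht.1, ht.2⟩)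
      (fun z hz => ⟨Z.min'_le z hz, (hZ z hz).2⟩) hcard hzero
    rw [iteratedDeriv_succ']
    exact ih (hg.deriv_of_isOpen isOpen_Ioo (by rfl))
      (fun z hz => ⟨ha'.1.trans (h2 z hz).1.1, (h2 z hz).1.2⟩) h1 fun z hz => (h2 z hz).2

theorem iteratedDeriv_eval (p : ℝ[X]) (m : ℕ) :
    iteratedDeriv m (fun t => p.eval t) = fun t => (derivative^[m] p).eval t := by
  induction m with
  | zero => simp
  | succ m ih =>
    rw [iteratedDeriv_succ, ih, Function.iterate_succ_apply']
    funext t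
    exact Polynomial.deriv _

theorem eval_iterate_derivative_of_natDegree_le {p : ℝ[X]} {m : ℕ} (hp : p.natDegree ≤ m) (t : ℝ) :
    (derivative^[m] p).eval t = m.factorial * p.coeff m := by
  have h : (derivative^[m] p).natDegree = 0 := by
    have := natDegree_iterate_derivative p m
    omega
  rw [eq_C_of_natDegree_eq_zero h, eval_C, coeff_iterate_derivative]
  simp [Nat.descFactorial_self]

end rolle

/-! ### Hermite interpolation and its error -/

section hermite

/-- The nodal polynomial with simple zeros on `S` and double zeros on `D`. -/
noncomputable def hermiteNodal (S D : Finset ℝ) : ℝ[X] :=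
  (∏ s ∈ S, (X - C s)) * (∏ d ∈ D, (X - C d)) ^ 2

theorem monic_hermiteNodal (S D : Finset ℝ) : (hermiteNodal S D).Monic :=
  (monic_prod_of_monic _ _ fun _ _ => monic_X_sub_C _).mul
    ((monic_prod_of_monic _ _ fun _ _ => monic_X_sub_C _).pow 2)

theorem natDegree_hermiteNodal (S D : Finset ℝ) :
    (hermiteNodal S D).natDegree = S.card + 2 * D.card := by
  rw [hermiteNodal, Monic.natDegree_mul (monic_prod_of_monic _ _ fun _ _ => monic_X_sub_C _)
    ((monic_prod_of_monic _ _ fun _ _ => monic_X_sub_C _).pow 2), natDegree_pow,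
    natDegree_prod_of_monic _ _ fun _ _ => monic_X_sub_C _,
    natDegree_prod_of_monic _ _ fun _ _ => monic_X_sub_C _]
  simp

theorem eval_hermiteNodal (S D : Finset ℝ) (t : ℝ) :
    (hermiteNodal S D).eval t = (∏ s ∈ S, (t - s)) * (∏ d ∈ D, (t - d)) ^ 2 := by
  simp [hermiteNodal, eval_prod]

theorem eval_hermiteNodal_eq_zero_iff {S D : Finset ℝ} {t : ℝ} :
    (hermiteNodal S D).eval t = 0 ↔ t ∈ S ∨ t ∈ D := by
  simp [eval_hermiteNodal, Finset.prod_eq_zero_iff, sub_eq_zero]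

theorem eval_derivative_hermiteNodal {S D : Finset ℝ} {d : ℝ} (hd : d ∈ D) :
    (derivative (hermiteNodal S D)).eval d = 0 := by
  have h : (∏ d ∈ D, (X - C d)).eval d = 0 := by
    rw [eval_prod]; exact Finset.prod_eq_zero hd (by simp)
  rw [hermiteNodal, derivative_mul, derivative_pow]
  simp [h]

theorem hermiteNodal_dvd {S D : Finset ℝ} (hSD : Disjoint S D) {G : ℝ[X]}
    (hS : ∀ s ∈ S, G.eval s = 0) (hD : ∀ d ∈ D, G.eval d = 0)
    (hD' : ∀ d ∈ D, (derivative G).eval d = 0) : hermiteNodal S D ∣ G := by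
  by_cases hG : G = 0
  · simp [hG]
  rw [hermiteNodal, ← Finset.prod_pow]
  refine IsCoprime.mul_dvd ?_ ?_ ?_
  · refine IsCoprime.prod_left fun s hs => IsCoprime.prod_right fun d hd => ?_
    exact (pairwise_coprime_X_sub_C Function.injective_id
      (fun h : s = d => Finset.disjoint_left.1 hSD hs (h ▸ hd))).pow_right
  · refine Finset.prod_dvd_of_coprime (fun s _ t _ hst =>
      pairwise_coprime_X_sub_C Function.injective_id hst) fun s hs => ?_
    exact dvd_iff_isRoot.2 (hS s hs)
  · refine Finset.prod_dvd_of_coprime (fun s _ t _ hst =>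
      (pairwise_coprime_X_sub_C Function.injective_id hst).pow) fun d hd => ?_
    exact (le_rootMultiplicity_iff hG).1
      ((one_lt_rootMultiplicity_iff_isRoot hG).2 ⟨hD d hd, hD' d hd⟩)

/-- `G` interpolates the values `v` on `S ∪ D` and the derivatives `w` on `D`. -/
structure IsHermite (v w : ℝ → ℝ) (S D : Finset ℝ) (G : ℝ[X]) : Prop where
  natDegree_lt : G.natDegree < S.card + 2 * D.card
  eval_simple : ∀ s ∈ S, G.eval s = v s
  eval_double : ∀ d ∈ D, G.eval d = v d
  deriv_double : ∀ d ∈ D, (derivative G).eval d = w d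

/-- A solution of the homogeneous problem is divisible by the nodal polynomial, of larger degree,
hence zero; equality of dimensions turns uniqueness into existence. -/
theorem existsUnique_isHermite (v w : ℝ → ℝ) {S D : Finset ℝ} (hSD : Disjoint S D)
    (hpos : 0 < S.card + 2 * D.card) : ∃! G, IsHermite v w S D G := by
  let Φ : degreeLT ℝ (S.card + 2 * D.card) →ₗ[ℝ] (S → ℝ) × ((D → ℝ) × (D → ℝ)) :=
    (LinearMap.prod (LinearMap.pi fun s : S => leval (s : ℝ))
      (LinearMap.prod (LinearMap.pi fun d : D => leval (d : ℝ))
        (LinearMap.pi fun d : D => leval (d : ℝ) ∘ₗ derivative))) ∘ₗ (degreeLT ℝ _).subtype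
  have hzero : ∀ G : ℝ[X], G.natDegree < S.card + 2 * D.card → (∀ s ∈ S, G.eval s = 0) →
      (∀ d ∈ D, G.eval d = 0) → (∀ d ∈ D, (derivative G).eval d = 0) → G = 0 := by
    intro G hG h1 h2 h3
    refine eq_zero_of_dvd_of_natDegree_lt (hermiteNodal_dvd hSD h1 h2 h3) ?_
    rwa [natDegree_hermiteNodal]
  have hinj : Function.Injective Φ := by
    rw [injective_iff_map_eq_zero]
    rintro ⟨G, hG⟩ h0
    have h1 := congrArg Prod.fst h0
    have h2 := congrArg (fun p => p.2.1) h0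
    have h3 := congrArg (fun p => p.2.2) h0
    refine Subtype.ext (hzero G (natDegree_lt_of_mem_degreeLT hpos hG) (fun s hs => ?_)
      (fun d hd => ?_) fun d hd => ?_)
    · exact congrFun h1 ⟨s, hs⟩
    · exact congrFun h2 ⟨d, hd⟩
    · exact congrFun h3 ⟨d, hd⟩
  have hfin : FiniteDimensional ℝ (degreeLT ℝ (S.card + 2 * D.card)) :=
    Module.Finite.equiv (degreeLTEquiv ℝ _).symm
  have hrank : Module.finrank ℝ (degreeLT ℝ (S.card + 2 * D.card)) =
      Module.finrank ℝ ((S → ℝ) × ((D → ℝ) × (D → ℝ))) := by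
    rw [(degreeLTEquiv ℝ _).finrank_eq]
    simp
    ring
  obtain ⟨⟨G, hG⟩, hΦ⟩ := (LinearMap.injective_iff_surjective_of_finrank_eq_finrank hrank).1 hinj
    (fun s => v s, fun d => v d, fun d => w d)
  refine ⟨G, ⟨natDegree_lt_of_mem_degreeLT hpos hG, fun s hs => ?_, fun d hd => ?_,
    fun d hd => ?_⟩, fun G' hG' => ?_⟩
  · exact congrFun (congrArg Prod.fst hΦ) ⟨s, hs⟩
  · exact congrFun (congrArg (fun p => p.2.1) hΦ) ⟨d, hd⟩
  · exact congrFun (congrArg (fun p => p.2.2) hΦ) ⟨d, hd⟩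
  · refine sub_eq_zero.1 (hzero _ ?_ (fun s hs => ?_) (fun d hd => ?_) fun d hd => ?_)
    · exact (natDegree_sub_le _ _).trans_lt
        (max_lt hG'.natDegree_lt (natDegree_lt_of_mem_degreeLT hpos hG))
    · have : G.eval s = v s := congrFun (congrArg Prod.fst hΦ) ⟨s, hs⟩
      rw [eval_sub, hG'.eval_simple s hs, this, sub_self]
    · have : G.eval d = v d := congrFun (congrArg (fun p => p.2.1) hΦ) ⟨d, hd⟩
      rw [eval_sub, hG'.eval_double d hd, this, sub_self]
    · have : (derivative G).eval d = w d := congrFun (congrArg (fun p => p.2.2) hΦ) ⟨d, hd⟩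
      rw [derivative_sub, eval_sub, hG'.deriv_double d hd, this, sub_self]

open Set in
/-- The error formula of Hermite interpolation. -/
theorem IsHermite.exists_error {f : ℝ → ℝ} {a b : ℝ}
    (hf : ContDiffOn ℝ ((⊤ : ℕ∞) : WithTop ℕ∞) f (Ico a b)) {S D : Finset ℝ} (hSD : Disjoint S D)
    (hS : ∀ s ∈ S, s ∈ Ico a b) (hD : ∀ d ∈ D, d ∈ Ioo a b) {G : ℝ[X]}
    (hG : IsHermite f (deriv f) S D G) {t : ℝ} (ht : t ∈ Ico a b) :
    ∃ ξ ∈ Ico a b, f t - G.eval t =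
      iteratedDerivWithin (S.card + 2 * D.card) f (Ico a b) ξ /
        (S.card + 2 * D.card).factorial * (hermiteNodal S D).eval t := by
  classical
  set m := S.card + 2 * D.card with hm
  by_cases hW : (hermiteNodal S D).eval t = 0
  · refine ⟨t, ht, ?_⟩
    rw [hW, mul_zero, sub_eq_zero]
    rcases eval_hermiteNodal_eq_zero_iff.1 hW with h | h
    · exact (hG.eval_simple t h).symm
    · exact (hG.eval_double t h).symm
  have hmpos : 0 < m := Nat.zero_lt_of_lt hG.natDegree_lt
  -- This choice makes Q = G + cW, with W the nodal polynomial, agree with f at t as well.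
  set c := (f t - G.eval t) / (hermiteNodal S D).eval t with hc
  set Q := G + C c * hermiteNodal S D with hQ
  set g : ℝ → ℝ := fun s => f s - Q.eval s with hg
  have hQc : ContDiff ℝ ((⊤ : ℕ∞) : WithTop ℕ∞) fun s => Q.eval s := by
    simpa [coe_aeval_eq_eval] using Q.contDiff_aeval (𝕜 := ℝ) _
  have hgc : ContDiffOn ℝ ((⊤ : ℕ∞) : WithTop ℕ∞) g (Ico a b) := hf.sub hQc.contDiffOn
  have hfat : ∀ x ∈ Ioo a b, ContDiffAt ℝ ((⊤ : ℕ∞) : WithTop ℕ∞) f x := fun x hx =>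
    (hf x ⟨hx.1.le, hx.2⟩).contDiffAt (Ico_mem_nhds hx.1 hx.2)
  have hg0 : ∀ z ∈ insert t (S ∪ D), g z = 0 := by
    intro z hz
    rcases Finset.mem_insert.1 hz with rfl | hz
    · simp only [hg, hQ, hc, eval_add, eval_mul, eval_C]
      rw [div_mul_cancel₀ _ hW]; ring
    · have h1 : (hermiteNodal S D).eval z = 0 :=
        eval_hermiteNodal_eq_zero_iff.2 (Finset.mem_union.1 hz)
      have h2 : G.eval z = f z := by
        rcases Finset.mem_union.1 hz with h | h
        · exact hG.eval_simple z h
        · exact hG.eval_double z h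
      simp [hg, hQ, h1, h2]
  have htn : t ∉ S ∪ D := fun h => hW (eval_hermiteNodal_eq_zero_iff.2 (Finset.mem_union.1 h))
  -- The nodes and t give |S| + |D| + 1 zeros of g. The first Rolle step uses [a, b), since t or a
  -- simple node may equal a. Its |S| + |D| zeros of g' lie in (a, b) and avoid D, whose points are
  -- further zeros of g': m in all.
  obtain ⟨Z', hZ'c, hZ'd, hZ'⟩ := exists_finset_deriv_eq_zero (m := S.card + D.card)
    hgc.continuousOn (Z := insert t (S ∪ D))
    (fun z hz => by
      rcases Finset.mem_insert.1 hz with rfl | hz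
      · exact ht
      · rcases Finset.mem_union.1 hz with h | h
        · exact hS z h
        · exact ⟨(hD z h).1.le, (hD z h).2⟩)
    (by rw [Finset.card_insert_of_notMem htn, Finset.card_union_of_disjoint hSD]) hg0
  have hdis : Disjoint Z' D := hZ'd.mono_right fun x hx =>
    Finset.mem_insert_of_mem (Finset.mem_union_right _ hx)
  obtain ⟨ξ, hξ, hξ0⟩ := exists_iteratedDeriv_eq_zero (a := a) (b := b) (m - 1) (g := deriv g)
    (Z := Z' ∪ D)
    ((hgc.mono Ioo_subset_Ico_self).deriv_of_isOpen isOpen_Ioo (by rfl))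
    (fun z hz => by
      rcases Finset.mem_union.1 hz with h | h
      · exact (hZ' z h).1
      · exact hD z h)
    (by rw [Finset.card_union_of_disjoint hdis, hZ'c]; omega)
    (fun z hz => by
      rcases Finset.mem_union.1 hz with h | h
      · exact (hZ' z h).2
      · have h1 : DifferentiableAt ℝ f z := (hfat z (hD z h)).differentiableAt (by simp)
        have h2 : deriv g z = deriv f z - (derivative Q).eval z :=
          (h1.hasDerivAt.sub (Q.hasDerivAt z)).deriv
        rw [h2, hQ, derivative_add, derivative_C_mul,
          eval_add, eval_mul, eval_derivative_hermiteNodal h, hG.deriv_double z h]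
        simp)
  rw [← iteratedDeriv_succ', Nat.sub_add_cancel hmpos] at hξ0
  refine ⟨ξ, ⟨hξ.1.le, hξ.2⟩, ?_⟩
  have hsub : iteratedDeriv m g ξ =
      iteratedDeriv m f ξ - iteratedDeriv m (fun s => Q.eval s) ξ :=
    iteratedDeriv_sub ((hfat ξ hξ).of_le (by exact_mod_cast le_top))
      (hQc.contDiffAt.of_le (by exact_mod_cast le_top))
  have hQd : Q.natDegree ≤ m := by
    refine (natDegree_add_le _ _).trans (max_le hG.natDegree_lt.le ?_)
    exact (natDegree_C_mul_le _ _).trans (natDegree_hermiteNodal S D).le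
  -- As G has degree below m and W is monic of degree m, the m-th derivative of Q is m! c.
  have hQm : Q.coeff m = c := by
    have h1 : (hermiteNodal S D).coeff m = 1 := by
      have := monic_hermiteNodal S D
      rwa [Monic, leadingCoeff, natDegree_hermiteNodal] at this
    rw [hQ, coeff_add, coeff_C_mul, h1, coeff_eq_zero_of_natDegree_lt hG.natDegree_lt]
    ring
  rw [hsub, iteratedDeriv_eval] at hξ0
  simp only at hξ0
  rw [eval_iterate_derivative_of_natDegree_le hQd, hQm] at hξ0
  rw [iteratedDerivWithin_eq_iteratedDeriv (uniqueDiffOn_Ico a b)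
    ((hfat ξ hξ).of_le (by exact_mod_cast le_top)) ⟨hξ.1.le, hξ.2⟩, sub_eq_zero.1 hξ0,
    mul_div_cancel_left₀ _ (by positivity), hc, div_mul_cancel₀ _ hW]

end hermite

/-! ### Absolutely monotone potentials and largest inner products -/

section potentials

variable {h : ℝ → ENNReal}

theorem IsAbsolutelyMonotone.error_sign (hh : IsAbsolutelyMonotone h) {S D : Finset ℝ}
    (hSD : Disjoint S D) (hS : ∀ s ∈ S, s ∈ Set.Ico (-1 : ℝ) 1)
    (hD : ∀ d ∈ D, d ∈ Set.Ioo (-1 : ℝ) 1) {G : ℝ[X]}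
    (hG : IsHermite (fun t => (h t).toReal) (deriv fun t => (h t).toReal) S D G) {t : ℝ}
    (ht : t ∈ Set.Ico (-1 : ℝ) 1) :
    ∃ c : ℝ, 0 ≤ c ∧ (h t).toReal - G.eval t = c * (hermiteNodal S D).eval t := by
  obtain ⟨ξ, hξ, he⟩ := hG.exists_error hh.2.1 hSD hS hD ht
  exact ⟨_, div_nonneg (hh.2.2 _ ξ hξ) (Nat.cast_nonneg _), he⟩

/-- Distinct points have inner product in [-1, 1), where h is finite; the possibly infinite h(1)
never enters. -/
theorem IsAbsolutelyMonotone.designEnergy_eq {n : ℕ} [DecidableEq (UnitSphere n)]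
    (hh : IsAbsolutelyMonotone h) (C : Finset (UnitSphere n)) :
    designEnergy h C = ENNReal.ofReal (∑ p ∈ C.offDiag, (h (sphereInner p.1 p.2)).toReal) := by
  rw [ENNReal.ofReal_sum_of_nonneg fun _ _ => ENNReal.toReal_nonneg, designEnergy]
  have e : ∀ p ∈ C.offDiag, h (sphereInner p.1 p.2) =
      ENNReal.ofReal (h (sphereInner p.1 p.2)).toReal := fun p hp => by
    rw [ENNReal.ofReal_toReal (hh.1 _ (sphereInner_mem_Ico (Finset.mem_offDiag.1 hp).2.2))]
  convert Finset.sum_congr rfl e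

end potentials

section maxInner

variable {n : ℕ}

theorem sphereInner_le_maxInner {C : Finset (UnitSphere n)} {x y : UnitSphere n} (hx : x ∈ C)
    (hy : y ∈ C) (hxy : x ≠ y) : sphereInner x y ≤ maxInner C := by
  refine le_csSup ⟨1, ?_⟩ ⟨x, hx, y, hy, hxy, rfl⟩
  rintro _ ⟨x, -, y, -, hxy, rfl⟩
  exact (sphereInner_mem_Ico hxy).2.le

theorem maxInner_le_one (C : Finset (UnitSphere n)) : maxInner C ≤ 1 := by
  refine Real.sSup_le ?_ zero_le_one
  rintro _ ⟨x, -, y, -, hxy, rfl⟩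
  exact (sphereInner_mem_Ico hxy).2.le

theorem maxInner_le_maxInnerSup {N τ : ℕ} {C : Finset (UnitSphere n)}
    (hC : IsSphericalDesign τ C) (hN : C.card = N) : maxInner C ≤ maxInnerSup n N τ := by
  refine le_csSup ⟨1, ?_⟩ ⟨C, hC, hN, rfl⟩
  rintro _ ⟨C, -, -, rfl⟩
  exact maxInner_le_one C

end maxInner

/-! ### Interpolants above and below the potential -/

section nodes

variable {k : ℕ} {α : Fin k → ℝ} {h : ℝ → ENNReal}

/-- Two simple nodes and k - 1 double ones make 2k conditions, matching degree at most 2k - 1. -/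
theorem isHermiteInterpolant_iff (hk : 1 ≤ k) (hα : StrictMono α)
    {j : Fin k} {u : ℝ} (hu : -1 < u) (G : ℝ[X]) :
    IsHermiteInterpolant h α j u G ↔
      IsHermite (fun t => (h t).toReal) (deriv fun t => (h t).toReal) {-1, u}
        ((Finset.univ.erase j).image α) G := by
  have hcard : ({-1, u} : Finset ℝ).card + 2 * ((Finset.univ.erase j).image α).card = 2 * k := by
    rw [Finset.card_pair hu.ne, Finset.card_image_of_injective _ hα.injective,
      Finset.card_erase_of_mem (Finset.mem_univ j), Finset.card_univ, Fintype.card_fin]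
    omega
  constructor
  · rintro ⟨h1, h2, h3, h4, h5⟩
    refine ⟨by rw [hcard]; omega, ?_, ?_, ?_⟩
    · intro s hs
      rcases Finset.mem_insert.1 hs with rfl | hs
      · exact h4
      · rw [Finset.mem_singleton.1 hs]; exact h5
    · intro d hd
      obtain ⟨i, hi, rfl⟩ := Finset.mem_image.1 hd
      exact h2 i (Finset.ne_of_mem_erase hi)
    · intro d hd
      obtain ⟨i, hi, rfl⟩ := Finset.mem_image.1 hd
      exact h3 i (Finset.ne_of_mem_erase hi)
  · rintro ⟨h1, h2, h3, h4⟩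
    rw [hcard] at h1
    refine ⟨by omega, fun i hi => h3 _ ?_, fun i hi => h4 _ ?_, h2 _ (by simp), h2 _ (by simp)⟩
    · exact Finset.mem_image_of_mem _ (Finset.mem_erase.2 ⟨hi, Finset.mem_univ i⟩)
    · exact Finset.mem_image_of_mem _ (Finset.mem_erase.2 ⟨hi, Finset.mem_univ i⟩)

theorem disjoint_pair_nodes {j : Fin k} {u : ℝ} (hα1 : ∀ i, -1 < α i) (hαu : ∀ i, α i < u) :
    Disjoint ({-1, u} : Finset ℝ) ((Finset.univ.erase j).image α) := by
  rw [Finset.disjoint_right]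
  intro d hd hd'
  obtain ⟨i, -, rfl⟩ := Finset.mem_image.1 hd
  rcases Finset.mem_insert.1 hd' with h1 | h1
  · exact (hα1 i).ne' h1
  · exact (hαu i).ne (Finset.mem_singleton.1 h1)

theorem IsHermiteInterpolant.le_eval (hk : 1 ≤ k) (hh : IsAbsolutelyMonotone h)
    (hα : StrictMono α) (hα1 : ∀ i, -1 < α i) {j : Fin k} {u : ℝ} (hαu : ∀ i, α i < u)
    (hu : u < 1) {G : ℝ[X]} (hG : IsHermiteInterpolant h α j u G) {t : ℝ}
    (ht : t ∈ Set.Icc (-1 : ℝ) u) : (h t).toReal ≤ G.eval t := by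
  have hu1 : -1 < u := (hα1 j).trans (hαu j)
  obtain ⟨c, hc, he⟩ := hh.error_sign (disjoint_pair_nodes hα1 hαu)
    (fun s hs => by
      rcases Finset.mem_insert.1 hs with rfl | hs
      · norm_num
      · rw [Finset.mem_singleton.1 hs]; exact ⟨hu1.le, hu⟩)
    (fun d hd => by
      obtain ⟨i, -, rfl⟩ := Finset.mem_image.1 hd
      exact ⟨hα1 i, (hαu i).trans hu⟩)
    ((isHermiteInterpolant_iff hk hα hu1 G).1 hG) (t := t) ⟨ht.1, ht.2.trans_lt hu⟩
  rw [eval_hermiteNodal, Finset.prod_pair hu1.ne] at he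
  -- The simple nodes alone decide the sign; the double nodes contribute a square.
  have h1 : (t - -1) * (t - u) ≤ 0 :=
    mul_nonpos_of_nonneg_of_nonpos (by linarith [ht.1]) (by linarith [ht.2])
  have h2 := mul_nonpos_of_nonneg_of_nonpos hc
    (mul_nonpos_of_nonpos_of_nonneg h1 (sq_nonneg
      (∏ d ∈ (Finset.univ.erase j).image α, (t - d))))
  linarith

/-- The Hermite interpolant at the doubled nodes stays below an absolutely monotone potential. -/
theorem IsAbsolutelyMonotone.exists_interpolant_le (hk : 1 ≤ k) (hh : IsAbsolutelyMonotone h)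
    (hα : StrictMono α) (hα1 : ∀ i, -1 < α i) (hαu : ∀ i, α i < 1) :
    ∃ H : ℝ[X], H.natDegree ≤ 2 * k - 1 ∧ (∀ i, H.eval (α i) = (h (α i)).toReal) ∧
      ∀ t ∈ Set.Ico (-1 : ℝ) 1, H.eval t ≤ (h t).toReal := by
  have hcard : (∅ : Finset ℝ).card + 2 * (Finset.univ.image α).card = 2 * k := by
    rw [Finset.card_image_of_injective _ hα.injective, Finset.card_univ, Fintype.card_fin]
    simp
  obtain ⟨H, hH, -⟩ := existsUnique_isHermite (fun t => (h t).toReal)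
    (deriv fun t => (h t).toReal) (Finset.disjoint_empty_left (Finset.univ.image α))
    (by omega)
  refine ⟨H, ?_, fun i => hH.eval_double _ (Finset.mem_image_of_mem _ (Finset.mem_univ i)),
    fun t ht => ?_⟩
  · have := hH.natDegree_lt
    omega
  · obtain ⟨c, hc, he⟩ := hh.error_sign (Finset.disjoint_empty_left _) (by simp)
      (fun d hd => by
        obtain ⟨i, -, rfl⟩ := Finset.mem_image.1 hd
        exact ⟨hα1 i, hαu i⟩) hH ht
    rw [eval_hermiteNodal, Finset.prod_empty, one_mul] at he
    have := mul_nonneg hc (sq_nonneg (∏ d ∈ Finset.univ.image α, (t - d)))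
    linarith

end nodes

/-! ### Energy bounds -/

section bounds

variable {n k N : ℕ} {α ρ : Fin k → ℝ} {h : ℝ → ENNReal}

theorem IsDesignQuadrature.energy_eq (hq : IsDesignQuadrature n N k α ρ) (hN : 0 < N) {f : ℝ[X]}
    (hf : f.natDegree ≤ 2 * k - 1) :
    (N : ℝ) * (gegenbauerZero n f * N - f.eval 1) = (N : ℝ) ^ 2 * ∑ i, ρ i * f.eval (α i) := by
  have h0 : (N : ℝ) ≠ 0 := by exact_mod_cast hN.ne'
  rw [hq.quadrature f hf]
  field_simp
  ring

/-- Interpolation replaces G by h at every quadrature node except αⱼ. -/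
theorem IsHermiteInterpolant.energy_eq (hq : IsDesignQuadrature n N k α ρ) (hN : 0 < N)
    {j : Fin k} {u : ℝ} {G : ℝ[X]} (hG : IsHermiteInterpolant h α j u G) :
    (N : ℝ) * (gegenbauerZero n G * N - G.eval 1) =
      (N : ℝ) ^ 2 * ∑ i, ρ i * (h (α i)).toReal +
        (N : ℝ) ^ 2 * ρ j * (G.eval (α j) - (h (α j)).toReal) := by
  have h1 : ∑ i, ρ i * (G.eval (α i) - (h (α i)).toReal) =
      ρ j * (G.eval (α j) - (h (α j)).toReal) :=
    Finset.sum_eq_single j (fun i _ hi => by rw [hG.eval_node i hi, sub_self, mul_zero]) (by simp)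
  simp only [mul_sub, Finset.sum_sub_distrib] at h1
  rw [hq.energy_eq hN hG.natDegree_le]
  linear_combination (N : ℝ) ^ 2 * h1

open Classical in
theorem IsHermiteInterpolant.sum_le (hn : 2 ≤ n) (hk : 1 ≤ k) (hh : IsAbsolutelyMonotone h)
    (hq : IsDesignQuadrature n N k α ρ) {j : Fin k} {u : ℝ} (hαu : ∀ i, α i < u) (hu : u < 1)
    {G : ℝ[X]} (hG : IsHermiteInterpolant h α j u G) {C : Finset (UnitSphere n)}
    (hC : IsSphericalDesign (2 * k - 1) C) (hCN : C.card = N) (hCu : maxInner C ≤ u) :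
    ∑ p ∈ C.offDiag, (h (sphereInner p.1 p.2)).toReal ≤
      N * (gegenbauerZero n G * N - G.eval 1) := by
  rw [← hCN, ← hC.sum_offDiag_eval hn hG.natDegree_le]
  refine Finset.sum_le_sum fun p hp => ?_
  obtain ⟨h1, h2, h3⟩ := Finset.mem_offDiag.1 hp
  exact hG.le_eval hk hh hq.strictMono hq.neg_one_lt hαu hu
    ⟨(sphereInner_mem_Ico h3).1, (sphereInner_le_maxInner h1 h2 h3).trans hCu⟩

open Classical in
theorem IsDesignQuadrature.le_sum (hn : 2 ≤ n) (hk : 1 ≤ k) (hh : IsAbsolutelyMonotone h)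
    (hq : IsDesignQuadrature n N k α ρ) (hN : 0 < N) {C : Finset (UnitSphere n)}
    (hC : IsSphericalDesign (2 * k - 1) C) (hCN : C.card = N) :
    (N : ℝ) ^ 2 * ∑ i, ρ i * (h (α i)).toReal ≤
      ∑ p ∈ C.offDiag, (h (sphereInner p.1 p.2)).toReal := by
  obtain ⟨H, hHd, hHe, hHle⟩ :=
    hh.exists_interpolant_le hk hq.strictMono hq.neg_one_lt hq.lt_one
  have h1 := hq.energy_eq hN hHd
  simp only [hHe] at h1
  rw [← h1, ← hCN, ← hC.sum_offDiag_eval hn hHd]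
  exact Finset.sum_le_sum fun p hp => hHle _ (sphereInner_mem_Ico (Finset.mem_offDiag.1 hp).2.2)

theorem IsHermiteInterpolant.energySup_sub_energyInf_le (hn : 2 ≤ n) (hk : 1 ≤ k)
    (hh : IsAbsolutelyMonotone h) (hq : IsDesignQuadrature n N k α ρ) (hN : 0 < N) {j : Fin k}
    {u : ℝ} (hαu : ∀ i, α i < u) (hu : u < 1) {G : ℝ[X]} (hG : IsHermiteInterpolant h α j u G)
    (hsup : maxInnerSup n N (2 * k - 1) ≤ u) :
    ((energySup n N (2 * k - 1) h : ENNReal) : EReal) -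
        ((energyInf n N (2 * k - 1) h : ENNReal) : EReal) ≤
      (((N : ℝ) ^ 2 * (ρ j * (G.eval (α j) - (h (α j)).toReal)) : ℝ) : EReal) := by
  classical
  rcases isEmpty_or_nonempty
    {C : Finset (UnitSphere n) // IsSphericalDesign (2 * k - 1) C ∧ C.card = N} with hE | ⟨⟨C₀, hC₀⟩⟩
  -- With no design the supremum is 0 and the infimum ∞, so the difference is -∞ in `EReal`.
  · rw [energySup, energyInf, iSup_of_empty, iInf_of_empty]
    simp
  set A : ℝ := (N : ℝ) ^ 2 * ∑ i, ρ i * (h (α i)).toReal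
  set B : ℝ := (N : ℝ) * (gegenbauerZero n G * N - G.eval 1)
  have hA0 : 0 ≤ A := mul_nonneg (sq_nonneg _)
    (Finset.sum_nonneg fun i _ => mul_nonneg (hq.weight_pos i).le ENNReal.toReal_nonneg)
  have hup : ∀ C : Finset (UnitSphere n), IsSphericalDesign (2 * k - 1) C → C.card = N →
      ∑ p ∈ C.offDiag, (h (sphereInner p.1 p.2)).toReal ≤ B := fun C hC hCN =>
    hG.sum_le hn hk hh hq hαu hu hC hCN ((maxInner_le_maxInnerSup hC hCN).trans hsup)
  have hAB : A ≤ B := (hq.le_sum hn hk hh hN hC₀.1 hC₀.2).trans (hup C₀ hC₀.1 hC₀.2)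
  have hU : ((energySup n N (2 * k - 1) h : ENNReal) : EReal) ≤ (B : EReal) := by
    rw [← max_eq_left (hA0.trans hAB), ← EReal.coe_ennreal_ofReal, EReal.coe_ennreal_le_coe_ennreal_iff]
    refine iSup_le fun C => ?_
    rw [hh.designEnergy_eq]
    exact ENNReal.ofReal_le_ofReal (hup C.1 C.2.1 C.2.2)
  have hL : (A : EReal) ≤ ((energyInf n N (2 * k - 1) h : ENNReal) : EReal) := by
    rw [← max_eq_left hA0, ← EReal.coe_ennreal_ofReal, EReal.coe_ennreal_le_coe_ennreal_iff]
    refine le_iInf fun C => ?_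
    rw [hh.designEnergy_eq]
    exact ENNReal.ofReal_le_ofReal (hq.le_sum hn hk hh hN C.2.1 C.2.2)
  refine (EReal.sub_le_sub hU hL).trans (le_of_eq ?_)
  rw [← EReal.coe_sub]
  congr 1
  have h1 : B = A + (N : ℝ) ^ 2 * ρ j * (G.eval (α j) - (h (α j)).toReal) := hG.energy_eq hq hN
  rw [h1]
  ring

end bounds

/-! ### Delsarte-Goethals-Seidel numbers and the main theorem -/

theorem dgsBound_odd {n k : ℕ} (hk : 1 ≤ k) :
    dgsBound n (2 * k - 1) = 2 * (n + k - 2).choose (n - 1) := by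
  have h1 : ¬ Even (2 * k - 1) := by
    rw [Nat.not_even_iff_odd]; exact ⟨k - 1, by omega⟩
  rw [dgsBound, if_neg h1, show (2 * k - 1 + 1) / 2 = k by omega]

/-- For n = 1 both numbers equal 2, leaving no room for N. -/
theorem two_le_of_dgsBound_lt {n k : ℕ} (hn : 1 ≤ n) (hk : 1 ≤ k)
    (h : dgsBound n (2 * k - 1) < dgsBound n (2 * k)) : 2 ≤ n := by
  by_contra hc
  obtain rfl : n = 1 := by omega
  rw [dgsBound_odd hk, dgsBound, if_pos (even_two_mul k)] at h
  simp at h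

end lemmas

theorem theorem3p7 (n k N : ℕ) (hn : 1 ≤ n) (hk : 1 ≤ k)
    (hN : dgsBound n (2 * k - 1) < N) (hN' : N ≤ dgsBound n (2 * k))
    (h : ℝ → ENNReal) (hh : IsAbsolutelyMonotone h) :
    (∃! q : (Fin k → ℝ) × (Fin k → ℝ), IsDesignQuadrature n N k q.1 q.2) ∧
    ∀ α ρ : Fin k → ℝ, IsDesignQuadrature n N k α ρ →
      ∀ u : ℝ, α ⟨k - 1, by omega⟩ < u → u < 1 →
        (∀ j : Fin k, ∃! G : Polynomial ℝ, IsHermiteInterpolant h α j u G) ∧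
        ∀ G : Fin k → Polynomial ℝ, (∀ j, IsHermiteInterpolant h α j u (G j)) →
          (∀ j : Fin k,
            (∀ C : Finset (UnitSphere n),
              IsSphericalDesign (2 * k - 1) C → C.card = N → maxInner C ≤ u →
                ((designEnergy h C : ENNReal) : EReal) ≤
                  (((N : ℝ) * (gegenbauerZero n (G j) * N - (G j).eval 1) : ℝ) : EReal)) ∧
            (N : ℝ) * (gegenbauerZero n (G j) * N - (G j).eval 1) =
              (N : ℝ) ^ 2 * ∑ i, ρ i * (h (α i)).toReal +
                (N : ℝ) ^ 2 * ρ j * ((G j).eval (α j) - (h (α j)).toReal)) ∧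
          (maxInnerSup n N (2 * k - 1) ≤ u →
            ((energySup n N (2 * k - 1) h : ENNReal) : EReal) -
                ((energyInf n N (2 * k - 1) h : ENNReal) : EReal) ≤
              (((N : ℝ) ^ 2 * ⨅ j : Fin k, ρ j * ((G j).eval (α j) - (h (α j)).toReal) : ℝ) :
                EReal)) := by

  have hn2 : 2 ≤ n := two_le_of_dgsBound_lt hn hk (hN.trans_le hN')
  have hN0 : 0 < N := Nat.zero_lt_of_lt hN
  rw [dgsBound_odd hk] at hN
  refine ⟨?_, fun α ρ hq u hαu hu => ⟨fun j => ?_, fun G hG => ⟨fun j => ⟨?_, ?_⟩, fun hsup => ?_⟩⟩⟩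
  · simp only [isDesignQuadrature_iff hn2]
    exact existsUnique_gaussQuadrature hk (posOnSquares_deletedFunctional_one_add hn2 hk hN)
      (posOnSquares_deletedFunctional_one_sub hn2 k)
  all_goals
    have hαu' : ∀ i, α i < u := fun i =>
      (hq.strictMono.monotone (Fin.le_def.2 (by simp; omega))).trans_lt hαu
  · simp only [isHermiteInterpolant_iff hk hq.strictMono ((hq.neg_one_lt j).trans (hαu' j))]
    refine existsUnique_isHermite _ _ (disjoint_pair_nodes hq.neg_one_lt hαu') ?_
    have : 0 < ({-1, u} : Finset ℝ).card := Finset.card_pos.2 ⟨u, by simp⟩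
    omega
  · intro C hC hCN hCu
    classical
    have h1 := (hG j).sum_le hn2 hk hh hq hαu' hu hC hCN hCu
    rw [hh.designEnergy_eq, EReal.coe_ennreal_ofReal,
      max_eq_left (Finset.sum_nonneg fun _ _ => ENNReal.toReal_nonneg)]
    exact EReal.coe_le_coe_iff.2 h1
  · exact (hG j).energy_eq hq hN0
  · have : Nonempty (Fin k) := ⟨⟨0, hk⟩⟩
    -- The infimum over the finite nonempty index set is attained, so the bound for a single j
    -- suffices.
    obtain ⟨j, hj⟩ := exists_eq_ciInf_of_finite
      (f := fun j : Fin k => ρ j * ((G j).eval (α j) - (h (α j)).toReal))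
    rw [← hj]
    exact (hG j).energySup_sub_energyInf_le hn2 hk hh hq hN0 hαu' hu hsup
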